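/- Let $n\ge 0$ and let $\theta_1,\dots,\theta_{n+3}\in\mathbb C\setminus\mathbb Z$, $\rho=-\tfrac12\sum_{j=1}^{n+3}\theta_j$. Let $U\subset\mathbb C^n$ be an open set of points $t=(t_1,\dots,t_n)$ such that $t_1,\dots,t_n$, $t_{n+1}:=0$, $t_{n+2}:=1$ are pairwise distinct. Let $A_j=\begin{pmatrix}a_j&b_j\\c_j&d_j\end{pmatrix}$ $(j=1,\dots,n+2)$ be a holomorphic solution on $U$ of the Schlesinger system $$dA_j=\sum_{i\ne j}[A_i,A_j]\,d\log(t_j-t_i),\qquad \det A_j=0,\quad \operatorname{tr}A_j=\theta_j,\quad -\sum_{j=1}^{n+2}A_j=\operatorname{diag}(\rho,\rho+\theta_{n+3}),$$ where $i$ runs over $1,\dots,n+2$ and $d$ is the exterior differential in $t_1,\dots,t_n$. Put $$C_{ij}=-\tfrac12\theta_i\theta_j+\frac{\theta_i^2+\theta_j^2}{2(n+1)}-\frac{\sum_{k=1}^{n+3}\theta_k^2}{2(n+1)(n+2)},\qquad H_i=\sum_{j=1,\,j\ne i}^{n+2}\frac{\operatorname{tr}A_iA_j+C_{ij}}{t_i-t_j}\quad(i=1,\dots,n).$$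 Assume $b_{n+1}d_{n+2}-d_{n+1}b_{n+2}\ne0$ on $U$, and let $T=T_{n+1,n+2}$ be the Schlesinger transformation with $T(\theta_j)=\theta_j+1$ for $j=n+1,n+2$ and $T(\theta_j)=\theta_j$ otherwise. It is induced by the gauge transformation $Y\mapsto\mathcal R(z)Y$ of $\frac{dY}{dz}=\sum_j\frac{A_j}{z-t_j}Y$, where $$\mathcal R(z)=(z-1)I+\widehat R,\qquad \widehat R=\frac{-1}{b_{n+1}d_{n+2}-d_{n+1}b_{n+2}}\begin{pmatrix}b_{n+1}\\d_{n+1}\end{pmatrix}\begin{pmatrix}-d_{n+2}&b_{n+2}\end{pmatrix};$$ that is, the matrices $T(A_j)$ are determined by $\sum_j\frac{T(A_j)}{z-t_j}=\Bigl(\mathcal R(z)\sum_j\frac{A_j}{z-t_j}+\mathcal R'(z)\Bigr)\mathcal R(z)^{-1}$. On any expression in $t$, the $\theta_j$ and the $A_j$, the map $T$ acts by substituting $T(\theta_j)$ and $T(A_j)$, leaving $t$ fixed. Let $\tau_0,\tau_1$ be nowhere vanishing holomorphic functions on $U$ with $$d\log\tau_0=\sum_{i=1}^nH_i\,dt_i,\qquad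 d\log\tau_1=\sum_{i=1}^nT(H_i)\,dt_i .$$ Put $\delta_i=t_i(t_i-1)\,\partial/\partial t_i$ and let $D^*_i$ be the Hirota derivatives with respect to the $\delta_i$: $$D^*_i\,\varphi\cdot\psi=\delta_i(\varphi)\psi-\varphi\,\delta_i(\psi),\qquad D^*_iD^*_j\,\varphi\cdot\psi=\delta_i\delta_j(\varphi)\psi-\delta_i(\varphi)\delta_j(\psi)-\delta_j(\varphi)\delta_i(\psi)+\varphi\,\delta_i\delta_j(\psi).$$ Put $$\widehat C_i=-\sum_{j=1,\,j\ne i}^{n+2}\frac{t_i(t_i-1)}{t_i-t_j}\Bigl(C_{ij}+\tfrac12\theta_i\theta_j\Bigr),\qquad \widehat C^*_i=T(\widehat C_i).$$ Then, for each $i=1,\dots,n$ and at every point of $U$ at which $2t_it_j-t_i-t_j\ne0$ for all $j=1,\dots,n$, $$\sum_{j=1}^n\frac{2}{2t_it_j-t_i-t_j}\bigl\{D^*_iD^*_j\,\tau_0\cdot\tau_1+F^i_j\,D^*_j\,\tau_0\cdot\tau_1\bigr\}+F^{i,0}D^*_i\,\tau_0\cdot\tau_1-\frac{2t_i-1}{t_i(t_i-1)}\,\delta_i(\tau_0)\,\tau_1+F^{i,1}\tau_0\tau_1=0,$$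 where $$F^i_j=\widehat C_i-\widehat C^*_i,\qquad F^{i,0}=\sum_{j=1}^n\frac{2(\widehat C_j-\widehat C^*_j)}{2t_it_j-t_i-t_j}-\frac{\theta_{n+1}}{t_i}-\frac{\theta_{n+2}}{t_i-1},$$ $$F^{i,1}=\sum_{j=1}^n\frac{2}{2t_it_j-t_i-t_j}\bigl\{\delta_j(\widehat C_i+\widehat C^*_i)+(\widehat C_i-\widehat C^*_i)(\widehat C_j-\widehat C^*_j)\bigr\}-\Bigl(\frac{\theta_{n+1}}{t_i}+\frac{\theta_{n+2}}{t_i-1}\Bigr)(\widehat C_i-\widehat C^*_i)-\frac{2t_i-1}{t_i(t_i-1)}\widehat C_i-\frac{\theta_i^2}{4t_i(t_i-1)}.$$ -/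

import Mathlib

open scoped BigOperators

namespace Schlesinger

noncomputable section

/-- `2 × 2` complex matrices. -/
abbrev Mat2 : Type := Matrix (Fin 2) (Fin 2) ℂ

/-- The finite singular points `t_1, …, t_n, t_{n+1} = 0, t_{n+2} = 1`. -/
def pts {n : ℕ} (t : Fin n → ℂ) : Fin (n + 2) → ℂ :=
  Fin.snoc (α := fun _ => ℂ) (Fin.snoc (α := fun _ => ℂ) t 0) 1

/-- The index `i ∈ {1, …, n}` among the `n + 2` finite singular points. -/
def ix {n : ℕ} (i : Fin n) : Fin (n + 2) := i.castSucc.castSucc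

/-- The index `n + 1` (the point `0`). -/
def ix0 (n : ℕ) : Fin (n + 2) := (Fin.last n).castSucc

/-- The index `n + 2` (the point `1`). -/
def ix1 (n : ℕ) : Fin (n + 2) := Fin.last (n + 1)

/-- The exponent `θ_j` for `j ∈ {1, …, n + 2}`; `θ (Fin.last (n + 2))` is `θ_{n+3}`. -/
def th {n : ℕ} (θ : Fin (n + 3) → ℂ) (j : Fin (n + 2)) : ℂ := θ j.castSucc

/-- `ρ = - (θ_1 + … + θ_{n+3}) / 2`. -/
def rho {n : ℕ} (θ : Fin (n + 3) → ℂ) : ℂ := -(∑ j, θ j) / 2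

/-- The partial derivative `∂ / ∂ t_k`. -/
def pd {n : ℕ} (k : Fin n) (f : (Fin n → ℂ) → ℂ) (t : Fin n → ℂ) : ℂ :=
  fderiv ℂ f t (Pi.single k 1)

/-- The derivation `δ_k = t_k (t_k - 1) ∂ / ∂ t_k`. -/
def dl {n : ℕ} (k : Fin n) (f : (Fin n → ℂ) → ℂ) (t : Fin n → ℂ) : ℂ :=
  t k * (t k - 1) * pd k f t

/-- `(A_1, …, A_{n+2})` is a holomorphic solution on `U` of the rank two Schlesinger system
`d A_j = ∑_{i ≠ j} [A_i, A_j] d log (t_j - t_i)` with exponents `θ_1, …, θ_{n+3}`. -/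
structure IsSolution {n : ℕ} (θ : Fin (n + 3) → ℂ) (U : Set (Fin n → ℂ))
    (A : (Fin n → ℂ) → Fin (n + 2) → Mat2) : Prop where
  not_int : ∀ (j : Fin (n + 3)) (m : ℤ), θ j ≠ (m : ℂ)
  holo : ∀ j a b, DifferentiableOn ℂ (fun t => A t j a b) U
  eqn : ∀ t ∈ U, ∀ (k : Fin n) (j : Fin (n + 2)) (a b : Fin 2),
    pd k (fun s => A s j a b) t =
      ∑ i ∈ Finset.univ.filter (fun i => i ≠ j),
        (A t i * A t j - A t j * A t i) a b *
          (pd k (fun s => pts s j - pts s i) t / (pts t j - pts t i))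
  det_eq : ∀ t ∈ U, ∀ j, (A t j).det = 0
  trace_eq : ∀ t ∈ U, ∀ j, (A t j).trace = th θ j
  sum_eq : ∀ t ∈ U, -(∑ j, A t j) =
    Matrix.diagonal ![rho θ, rho θ + θ (Fin.last (n + 2))]

/-- The constants `C_{ij}` entering the Hamiltonians. -/
def C {n : ℕ} (θ : Fin (n + 3) → ℂ) (i j : Fin (n + 2)) : ℂ :=
  -(1 / 2) * th θ i * th θ j + (th θ i ^ 2 + th θ j ^ 2) / (2 * ((n : ℂ) + 1))
    - (∑ k, θ k ^ 2) / (2 * ((n : ℂ) + 1) * ((n : ℂ) + 2))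

/-- The Hamiltonian `H_i = ∑_{j ≠ i} (tr A_i A_j + C_{ij}) / (t_i - t_j)`. -/
def H {n : ℕ} (θ : Fin (n + 3) → ℂ) (t : Fin n → ℂ) (A : Fin (n + 2) → Mat2) (i : Fin n) : ℂ :=
  ∑ j ∈ Finset.univ.filter (fun j => j ≠ ix i),
    1 / (pts t (ix i) - pts t j) * ((A (ix i) * A j).trace + C θ (ix i) j)

/-- `τ` is a `τ`-function on `U` for the Hamiltonians built from `θ` and `A`:
`d log τ = ∑_i H_i d t_i`. -/
structure IsTau {n : ℕ} (θ : Fin (n + 3) → ℂ) (U : Set (Fin n → ℂ))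
    (A : (Fin n → ℂ) → Fin (n + 2) → Mat2) (τ : (Fin n → ℂ) → ℂ) : Prop where
  holo : DifferentiableOn ℂ τ U
  ne_zero : ∀ t ∈ U, τ t ≠ 0
  dlog : ∀ t ∈ U, ∀ i, pd i τ t / τ t = H θ t (A t) i

/-- The denominator `b_k d_l - d_k b_l`. -/
def wedge {m : ℕ} (A : Fin m → Mat2) (k l : Fin m) : ℂ :=
  A k 0 1 * A l 1 1 - A k 1 1 * A l 0 1

/-- The matrix `R_{k,l}`. -/
def R {m : ℕ} (p : Fin m → ℂ) (A : Fin m → Mat2) (k l : Fin m) : Mat2 :=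
  ((p k - p l) / wedge A k l) •
    Matrix.vecMulVec ![A k 0 1, A k 1 1] ![-(A l 1 1), A l 0 1]

/-- `R*_{k,l} = (t_k - t_l) I + R_{k,l}`. -/
def Rstar {m : ℕ} (p : Fin m → ℂ) (A : Fin m → Mat2) (k l : Fin m) : Mat2 :=
  (p k - p l) • (1 : Mat2) + R p A k l

/-- The Schlesinger transformation `T_{k,l}` on the exponents:
`θ_k ↦ θ_k + 1`, `θ_l ↦ θ_l + 1`. -/
def shift {n : ℕ} (θ : Fin (n + 3) → ℂ) (k l : Fin (n + 2)) : Fin (n + 3) → ℂ :=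
  fun j => θ j + (if j = k.castSucc then 1 else 0) + (if j = l.castSucc then 1 else 0)

/-- The Schlesinger transformation `T_{k,l}` on the matrices `A_j` (for `k ≠ l`): the residue at
`p j` of `(𝓡 (z) A(z) + 𝓡' (z)) 𝓡 (z)⁻¹`, where `A(z) = ∑_j A_j / (z - p j)` and
`𝓡 (z) = (z - p l) I + R_{k,l}`; see `T_gauge`, `T_trace`, `T_det`, `T_sum` below. -/
def T {m : ℕ} (p : Fin m → ℂ) (A : Fin m → Mat2) (k l : Fin m) (j : Fin m) : Mat2 :=
  if j = k then
    -((1 + (A k).trace) / (p k - p l)) • R p A k l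
      - ∑ i ∈ Finset.univ.filter (fun i => i ≠ k),
          (1 / ((p k - p i) * (p k - p l))) • (Rstar p A k l * A i * R p A k l)
  else if j = l then
    ((1 + (A l).trace) / (p k - p l)) • Rstar p A k l
      + ∑ i ∈ Finset.univ.filter (fun i => i ≠ l),
          (1 / ((p l - p i) * (p k - p l))) • (R p A k l * A i * Rstar p A k l)
  else
    (1 / ((p j - p k) * (p j - p l))) •
      (((p j - p l) • (1 : Mat2) + R p A k l) * A j * ((p j - p k) • (1 : Mat2) - R p A k l))

/-- Elementary relations between `A_k`, `A_l` and `R_{k,l}`. -/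
theorem R_relations {m : ℕ} (p : Fin m → ℂ) (A : Fin m → Mat2) (k l : Fin m)
    (hk : (A k).det = 0) (hl : (A l).det = 0) (hw : wedge A k l ≠ 0) :
    R p A k l * A k = -(p k - p l) • A k ∧ R p A k l * A l = 0 ∧
    A k * R p A k l = (A k).trace • R p A k l ∧
    A l * Rstar p A k l = (A l).trace • Rstar p A k l ∧
    R p A k l * R p A k l = -(p k - p l) • R p A k l ∧
    (R p A k l).trace = -(p k - p l) ∧ (R p A k l).det = 0 ∧ (Rstar p A k l).det = 0 := by
  rw [Matrix.det_fin_two] at hk hl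
  unfold Rstar R
  unfold wedge at *
  generalize p k - p l = c
  generalize A k = X at *
  generalize A l = Y at *
  refine ⟨?_, ?_, ?_, ?_, ?_, ?_, ?_, ?_⟩
  · ext a b
    fin_cases a <;> fin_cases b <;>
      simp [Matrix.mul_apply, Fin.sum_univ_two] <;> field_simp <;>
      grind
  · ext a b
    fin_cases a <;> fin_cases b <;>
      simp [Matrix.mul_apply, Fin.sum_univ_two] <;> field_simp <;>
      grind
  · ext a b
    fin_cases a <;> fin_cases b <;>
      simp [Matrix.mul_apply, Fin.sum_univ_two,
        Matrix.trace_fin_two] <;> field_simp <;>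
      grind
  · ext a b
    fin_cases a <;> fin_cases b <;>
      simp [Matrix.mul_apply, Fin.sum_univ_two,
        Matrix.trace_fin_two] <;> field_simp <;>
      grind
  · ext a b
    fin_cases a <;> fin_cases b <;>
      simp [Matrix.mul_apply, Fin.sum_univ_two] <;> field_simp <;>
      grind
  · simp [Matrix.trace_fin_two]
    field_simp
    grind
  · simp [Matrix.det_fin_two]
    field_simp
    grind
  · simp [Matrix.det_fin_two]
    field_simp
    grind

/-- Splitting a weighted sum of the transformed matrices. -/
theorem sum_T {m : ℕ} (p : Fin m → ℂ) (A : Fin m → Mat2) (k l : Fin m)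
    (hp : Function.Injective p) (hkl : k ≠ l)
    (hk : (A k).det = 0) (hl : (A l).det = 0) (hw : wedge A k l ≠ 0) (x : Fin m → ℂ) :
    ∑ j, x j • T p A k l j =
      (x k • (-((1 + (A k).trace) / (p k - p l)) • R p A k l
          - (1 / (p k - p l)) • (A l * R p A k l))
        + x l • (((1 + (A l).trace) / (p k - p l)) • Rstar p A k l
          + (1 / (p k - p l)) • (A k * Rstar p A k l)))
      + ∑ j ∈ (Finset.univ.erase k).erase l,
        ((x j / ((p j - p k) * (p j - p l))) •
          (((p j - p l) • (1 : Mat2) + R p A k l) * A j *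
            ((p j - p k) • (1 : Mat2) - R p A k l))
        - (x k / ((p k - p j) * (p k - p l))) • (Rstar p A k l * A j * R p A k l)
        + (x l / ((p l - p j) * (p k - p l))) • (R p A k l * A j * Rstar p A k l)) := by
  obtain ⟨h1, h2, -, -, -, -, -, -⟩ := R_relations p A k l hk hl hw
  have hc : p k - p l ≠ 0 := sub_ne_zero.mpr fun h => hkl (hp h)
  have hlk : l ∈ Finset.univ.erase k := by simp [hkl.symm]
  have hkl' : k ∈ Finset.univ.erase l := by simp [hkl]
  rw [← Finset.add_sum_erase _ _ (Finset.mem_univ k), ← Finset.add_sum_erase _ _ hlk]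
  have hTk : T p A k l k = (-((1 + (A k).trace) / (p k - p l)) • R p A k l
      - (1 / (p k - p l)) • (A l * R p A k l))
      - ∑ j ∈ (Finset.univ.erase k).erase l,
        (1 / ((p k - p j) * (p k - p l))) • (Rstar p A k l * A j * R p A k l) := by
    rw [T, if_pos rfl, Finset.filter_ne', ← Finset.add_sum_erase _ _ hlk, ← sub_sub]
    congr 2
    rw [Rstar, add_mul, h2, add_zero, smul_mul_assoc, one_mul, smul_mul_assoc, smul_smul]
    congr 1
    field_simp
  have hTl : T p A k l l = (((1 + (A l).trace) / (p k - p l)) • Rstar p A k l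
          + (1 / (p k - p l)) • (A k * Rstar p A k l))
      + ∑ j ∈ (Finset.univ.erase k).erase l,
        (1 / ((p l - p j) * (p k - p l))) • (R p A k l * A j * Rstar p A k l) := by
    rw [T, if_neg hkl.symm, if_pos rfl, Finset.filter_ne', ← Finset.add_sum_erase _ _ hkl',
      ← add_assoc, Finset.erase_right_comm]
    congr 2
    rw [h1, smul_mul_assoc, smul_smul]
    congr 1
    have : p l - p k ≠ 0 := sub_ne_zero.mpr fun h => hkl (hp h).symm
    field_simp
    ring
  have hTj : ∀ j ∈ (Finset.univ.erase k).erase l, x j • T p A k l j =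
      (x j / ((p j - p k) * (p j - p l))) •
          (((p j - p l) • (1 : Mat2) + R p A k l) * A j *
            ((p j - p k) • (1 : Mat2) - R p A k l)) := by
    intro j hj
    simp only [Finset.mem_erase, Finset.mem_univ, and_true] at hj
    rw [T, if_neg hj.2, if_neg hj.1, smul_smul]
    congr 1
    ring
  rw [hTk, hTl, Finset.sum_congr rfl hTj, Finset.sum_add_distrib, Finset.sum_sub_distrib]
  simp only [smul_sub, smul_add, Finset.smul_sum, smul_smul, mul_one_div]
  abel

/-- `T_{k,l}` comes from the gauge transformation `Y ↦ 𝓡 (z) Y` of the linear system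
`d Y / d z = A(z) Y`, with `𝓡 (z) = (z - p l) I + R_{k,l}`:
the transformed system satisfies `T(A)(z) 𝓡 (z) = 𝓡 (z) A(z) + 𝓡' (z)`. -/
theorem T_gauge {m : ℕ} (p : Fin m → ℂ) (A : Fin m → Mat2) (k l : Fin m)
    (hp : Function.Injective p) (hkl : k ≠ l)
    (hk : (A k).det = 0) (hl : (A l).det = 0) (hw : wedge A k l ≠ 0)
    (z : ℂ) (hz : ∀ j, z ≠ p j) :
    (∑ j, (1 / (z - p j)) • T p A k l j) * ((z - p l) • (1 : Mat2) + R p A k l) =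
      ((z - p l) • (1 : Mat2) + R p A k l) * (∑ j, (1 / (z - p j)) • A j) + 1 := by
  obtain ⟨h1, h2, h3, h4, h5, -, -, -⟩ := R_relations p A k l hk hl hw
  have hc : p k - p l ≠ 0 := sub_ne_zero.mpr fun h => hkl (hp h)
  have hlk : l ∈ Finset.univ.erase k := by simp [hkl.symm]
  have hzk : z - p k ≠ 0 := sub_ne_zero.mpr (hz k)
  have hzl : z - p l ≠ 0 := sub_ne_zero.mpr (hz l)
  rw [sum_T p A k l hp hkl hk hl hw, ← Finset.add_sum_erase _ _ (Finset.mem_univ k),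
    ← Finset.add_sum_erase _ _ hlk, add_mul,
    mul_add ((z - p l) • (1 : Mat2) + R p A k l), mul_add ((z - p l) • (1 : Mat2) + R p A k l),
    Finset.sum_mul, Finset.mul_sum]
  have hrN : R p A k l * ((z - p l) • (1 : Mat2) + R p A k l) = (z - p k) • R p A k l := by
    rw [mul_add, h5, mul_smul_comm, mul_one, ← add_smul]
    congr 1
    ring
  have hsN : Rstar p A k l * ((z - p l) • (1 : Mat2) + R p A k l)
      = (z - p l) • Rstar p A k l := by
    rw [Rstar, add_mul, hrN]
    simp only [smul_mul_assoc, one_mul, smul_add, smul_smul]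
    module
  have hrest : ∀ j ∈ (Finset.univ.erase k).erase l,
      ((1 / (z - p j) / ((p j - p k) * (p j - p l))) •
          (((p j - p l) • (1 : Mat2) + R p A k l) * A j *
            ((p j - p k) • (1 : Mat2) - R p A k l))
        - (1 / (z - p k) / ((p k - p j) * (p k - p l))) • (Rstar p A k l * A j * R p A k l)
        + (1 / (z - p l) / ((p l - p j) * (p k - p l))) • (R p A k l * A j * Rstar p A k l)) *
        ((z - p l) • (1 : Mat2) + R p A k l) =
      ((z - p l) • (1 : Mat2) + R p A k l) * (1 / (z - p j)) • A j := by
    intro j hj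
    simp only [Finset.mem_erase, Finset.mem_univ, and_true] at hj
    have hzj : z - p j ≠ 0 := sub_ne_zero.mpr (hz j)
    have hjk : p j - p k ≠ 0 := sub_ne_zero.mpr fun h => hj.2 (hp h)
    have hjl : p j - p l ≠ 0 := sub_ne_zero.mpr fun h => hj.1 (hp h)
    have hkj : p k - p j ≠ 0 := sub_ne_zero.mpr fun h => hj.2 (hp h).symm
    have hlj : p l - p j ≠ 0 := sub_ne_zero.mpr fun h => hj.1 (hp h).symm
    have key : (1 / (z - p j) / ((p j - p k) * (p j - p l))) •
          (((p j - p l) • (1 : Mat2) + R p A k l) * A j *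
            ((p j - p k) • (1 : Mat2) - R p A k l))
        - (1 / (z - p k) / ((p k - p j) * (p k - p l))) • (Rstar p A k l * A j * R p A k l)
        + (1 / (z - p l) / ((p l - p j) * (p k - p l))) • (R p A k l * A j * Rstar p A k l)
        = (1 / ((z - p j) * (z - p k) * (z - p l))) •
          (((z - p l) • (1 : Mat2) + R p A k l) * A j *
            ((z - p k) • (1 : Mat2) - R p A k l)) := by
      simp only [Rstar, add_mul, mul_add, mul_sub, sub_mul, smul_mul_assoc, mul_smul_comm,
        one_mul, mul_one]
      match_scalars <;> field_simp <;> ring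
    have hMN : ((z - p k) • (1 : Mat2) - R p A k l) * ((z - p l) • (1 : Mat2) + R p A k l)
        = ((z - p k) * (z - p l)) • (1 : Mat2) := by
      rw [sub_mul, hrN]
      simp only [smul_mul_assoc, one_mul, smul_add, smul_smul]
      module
    rw [key, smul_mul_assoc, mul_assoc (_ * A j), hMN, mul_smul_comm, mul_one, smul_smul, mul_smul_comm]
    congr 1
    field_simp
  rw [Finset.sum_congr rfl hrest]
  have hNk : ((z - p l) • (1 : Mat2) + R p A k l) * (1 / (z - p k)) • A k = A k := by
    rw [mul_smul_comm, add_mul, h1, smul_mul_assoc, one_mul, ← add_smul, smul_smul]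
    convert one_smul ℂ (A k) using 2
    field_simp
    ring
  have hNl : ((z - p l) • (1 : Mat2) + R p A k l) * (1 / (z - p l)) • A l = A l := by
    rw [mul_smul_comm, add_mul, h2, smul_mul_assoc, one_mul, add_zero, smul_smul]
    convert one_smul ℂ (A l) using 2
    field_simp
  rw [hNk, hNl]
  have hhead : ((1 / (z - p k)) • (-((1 + (A k).trace) / (p k - p l)) • R p A k l
          - (1 / (p k - p l)) • (A l * R p A k l))
        + (1 / (z - p l)) • (((1 + (A l).trace) / (p k - p l)) • Rstar p A k l
          + (1 / (p k - p l)) • (A k * Rstar p A k l))) *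
        ((z - p l) • (1 : Mat2) + R p A k l) = A k + A l + 1 := by
    simp only [add_mul _ _ ((z - p l) • (1 : Mat2) + R p A k l), sub_mul, smul_mul_assoc,
      mul_assoc, hrN, hsN]
    have h4' : A l * R p A k l = (A l).trace • Rstar p A k l - (p k - p l) • A l := by
      rw [← h4, Rstar, mul_add, mul_smul_comm, mul_one]
      abel
    have h3' : A k * Rstar p A k l = (p k - p l) • A k + (A k).trace • R p A k l := by
      rw [← h3, Rstar, mul_add, mul_smul_comm, mul_one]
    rw [mul_smul_comm, mul_smul_comm, h4', h3', Rstar]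
    match_scalars <;> field_simp <;> ring
  rw [hhead]
  abel

/-- The exponents are shifted by one at `k` and `l`. -/
theorem T_trace {m : ℕ} (p : Fin m → ℂ) (A : Fin m → Mat2) (k l : Fin m)
    (hp : Function.Injective p) (hkl : k ≠ l)
    (hk : (A k).det = 0) (hl : (A l).det = 0) (hw : wedge A k l ≠ 0) (j : Fin m) :
    (T p A k l j).trace =
      (A j).trace + (if j = k then 1 else 0) + (if j = l then 1 else 0) := by
  obtain ⟨-, -, -, -, h5, h6, -, -⟩ := R_relations p A k l hk hl hw
  have hc : p k - p l ≠ 0 := sub_ne_zero.mpr fun h => hkl (hp h)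
  have hrs : R p A k l * Rstar p A k l = 0 := by
    rw [Rstar, mul_add, h5, mul_smul_comm, mul_one]
    module
  have hsr : Rstar p A k l * R p A k l = 0 := by
    rw [Rstar, add_mul, h5, smul_mul_assoc, one_mul]
    module
  have hts : (Rstar p A k l).trace = p k - p l := by
    rw [Rstar, Matrix.trace_add, h6, Matrix.trace_smul, Matrix.trace_one]
    simp
    ring
  unfold T
  split_ifs with h h' h'
  · exact absurd (h.symm.trans h') hkl
  · subst h
    rw [Matrix.trace_sub, Matrix.trace_sum, Matrix.trace_smul, h6, Finset.sum_eq_zero]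
    · simp only [smul_eq_mul]
      field_simp
      ring
    · intro i _
      rw [Matrix.trace_smul, mul_assoc, Matrix.trace_mul_comm, mul_assoc, hrs]
      simp
  · subst h'
    rw [Matrix.trace_add, Matrix.trace_sum, Matrix.trace_smul, hts, Finset.sum_eq_zero]
    · simp only [smul_eq_mul]
      field_simp
      ring
    · intro i _
      rw [Matrix.trace_smul, mul_assoc, Matrix.trace_mul_comm, mul_assoc, hsr]
      simp
  · have hjk : p j - p k ≠ 0 := sub_ne_zero.mpr fun e => h (hp e)
    have hjl : p j - p l ≠ 0 := sub_ne_zero.mpr fun e => h' (hp e)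
    have hMN : ((p j - p k) • (1 : Mat2) - R p A k l) * ((p j - p l) • (1 : Mat2) + R p A k l)
        = ((p j - p k) * (p j - p l)) • (1 : Mat2) := by
      simp only [sub_mul, mul_add, h5, smul_mul_assoc, mul_smul_comm, one_mul,
        mul_one]
      module
    rw [Matrix.trace_smul, mul_assoc, Matrix.trace_mul_comm, mul_assoc, hMN]
    simp only [mul_smul_comm, mul_one, Matrix.trace_smul, smul_eq_mul]
    field_simp
    ring

/-- The transformed matrices are again singular. -/
theorem T_det {m : ℕ} (p : Fin m → ℂ) (A : Fin m → Mat2) (k l : Fin m)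
    (hA : ∀ j, (A j).det = 0) (hw : wedge A k l ≠ 0) (j : Fin m) :
    (T p A k l j).det = 0 := by
  obtain ⟨-, -, -, -, -, -, h7, h8⟩ := R_relations p A k l (hA k) (hA l) hw
  unfold T
  split_ifs
  · have : (-((1 + (A k).trace) / (p k - p l)) • R p A k l
      - ∑ i ∈ Finset.univ.filter (fun i => i ≠ k),
          (1 / ((p k - p i) * (p k - p l))) • (Rstar p A k l * A i * R p A k l)) =
        (-((1 + (A k).trace) / (p k - p l)) • (1 : Mat2)
      - ∑ i ∈ Finset.univ.filter (fun i => i ≠ k),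
          (1 / ((p k - p i) * (p k - p l))) • (Rstar p A k l * A i)) * R p A k l := by
      simp only [sub_mul, Finset.sum_mul, smul_mul_assoc, one_mul]
    rw [this, Matrix.det_mul, h7, mul_zero]
  · have : (((1 + (A l).trace) / (p k - p l)) • Rstar p A k l
      + ∑ i ∈ Finset.univ.filter (fun i => i ≠ l),
          (1 / ((p l - p i) * (p k - p l))) • (R p A k l * A i * Rstar p A k l)) =
        (((1 + (A l).trace) / (p k - p l)) • (1 : Mat2)
      + ∑ i ∈ Finset.univ.filter (fun i => i ≠ l),
          (1 / ((p l - p i) * (p k - p l))) • (R p A k l * A i)) * Rstar p A k l := by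
      simp only [add_mul, Finset.sum_mul, smul_mul_assoc, one_mul]
    rw [this, Matrix.det_mul, h8, mul_zero]
  · rw [Matrix.det_smul, Matrix.det_mul, Matrix.det_mul, hA j]
    simp

/-- The residue at infinity: `ρ ↦ ρ - 1`, while `θ_{n+3}` is unchanged. -/
theorem T_sum {m : ℕ} (p : Fin m → ℂ) (A : Fin m → Mat2) (k l : Fin m)
    (hp : Function.Injective p) (hkl : k ≠ l)
    (hk : (A k).det = 0) (hl : (A l).det = 0) (hw : wedge A k l ≠ 0) :
    ∑ j, T p A k l j = ∑ j, A j + 1 := by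
  obtain ⟨-, -, h3, h4, -, -, -, -⟩ := R_relations p A k l hk hl hw
  have hc : p k - p l ≠ 0 := sub_ne_zero.mpr fun h => hkl (hp h)
  have hlk : l ∈ Finset.univ.erase k := by simp [hkl.symm]
  have h := sum_T p A k l hp hkl hk hl hw (fun _ => 1)
  simp only [one_smul] at h
  rw [h, ← Finset.add_sum_erase _ _ (Finset.mem_univ k), ← Finset.add_sum_erase _ _ hlk]
  have hrest : ∀ j ∈ (Finset.univ.erase k).erase l,
      ((1 / ((p j - p k) * (p j - p l))) •
          (((p j - p l) • (1 : Mat2) + R p A k l) * A j *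
            ((p j - p k) • (1 : Mat2) - R p A k l))
        - (1 / ((p k - p j) * (p k - p l))) • (Rstar p A k l * A j * R p A k l)
        + (1 / ((p l - p j) * (p k - p l))) • (R p A k l * A j * Rstar p A k l)) = A j := by
    intro j hj
    simp only [Finset.mem_erase, Finset.mem_univ, and_true] at hj
    have hjk : p j - p k ≠ 0 := sub_ne_zero.mpr fun h => hj.2 (hp h)
    have hjl : p j - p l ≠ 0 := sub_ne_zero.mpr fun h => hj.1 (hp h)
    have hkj : p k - p j ≠ 0 := sub_ne_zero.mpr fun h => hj.2 (hp h).symm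
    have hlj : p l - p j ≠ 0 := sub_ne_zero.mpr fun h => hj.1 (hp h).symm
    simp only [Rstar, add_mul, mul_add, mul_sub, sub_mul, smul_mul_assoc, mul_smul_comm,
      one_mul, mul_one]
    match_scalars <;> field_simp <;> ring
  rw [Finset.sum_congr rfl hrest]
  have h4' : A l * R p A k l = (A l).trace • Rstar p A k l - (p k - p l) • A l := by
    rw [← h4, Rstar, mul_add, mul_smul_comm, mul_one]
    abel
  have h3' : A k * Rstar p A k l = (p k - p l) • A k + (A k).trace • R p A k l := by
    rw [← h3, Rstar, mul_add, mul_smul_comm, mul_one]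
  have hhead : (-((1 + (A k).trace) / (p k - p l)) • R p A k l
          - (1 / (p k - p l)) • (A l * R p A k l))
        + (((1 + (A l).trace) / (p k - p l)) • Rstar p A k l
          + (1 / (p k - p l)) • (A k * Rstar p A k l)) = A k + A l + 1 := by
    rw [h4', h3', Rstar]
    match_scalars <;> field_simp <;> ring
  rw [hhead]
  abel

/-- The first order Hirota derivative with respect to `δ_i`. -/
def hirota1 {n : ℕ} (i : Fin n) (φ ψ : (Fin n → ℂ) → ℂ) (t : Fin n → ℂ) : ℂ :=
  dl i φ t * ψ t - φ t * dl i ψ t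

/-- The second order Hirota derivative with respect to `δ_i` and `δ_j`. -/
def hirota2 {n : ℕ} (i j : Fin n) (φ ψ : (Fin n → ℂ) → ℂ) (t : Fin n → ℂ) : ℂ :=
  dl i (dl j φ) t * ψ t - dl i φ t * dl j ψ t - dl j φ t * dl i ψ t + φ t * dl i (dl j ψ) t

/-- `Ĉ_i = Ĥ_i - δ_i log τ_0`, where
`Ĥ_i = ∑_{j ≠ i} t_i (t_i - 1) / (t_i - t_j) * (tr A_i A_j - θ_i θ_j / 2)`. -/
def Chat {n : ℕ} (θ : Fin (n + 3) → ℂ) (i : Fin n) (t : Fin n → ℂ) : ℂ :=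
  -∑ j ∈ Finset.univ.filter (fun j => j ≠ ix i),
    t i * (t i - 1) / (pts t (ix i) - pts t j) * (C θ (ix i) j + 1 / 2 * th θ (ix i) * th θ j)

/-- `Ĉ*_i = T_{n+1,n+2}(Ĉ_i)`. -/
def ChatStar {n : ℕ} (θ : Fin (n + 3) → ℂ) (i : Fin n) (t : Fin n → ℂ) : ℂ :=
  Chat (shift θ (ix0 n) (ix1 n)) i t

/-- The coefficient `F^i_j` (which does not depend on `j`). -/
def Fcoef {n : ℕ} (θ : Fin (n + 3) → ℂ) (i _j : Fin n) (t : Fin n → ℂ) : ℂ :=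
  Chat θ i t - ChatStar θ i t

/-- The coefficient `F^{i,0}`. -/
def F0 {n : ℕ} (θ : Fin (n + 3) → ℂ) (i : Fin n) (t : Fin n → ℂ) : ℂ :=
  (∑ j, 2 * (Chat θ j t - ChatStar θ j t) / (2 * t i * t j - t i - t j))
    - th θ (ix0 n) / t i - th θ (ix1 n) / (t i - 1)

/-- The coefficient `F^{i,1}`. -/
def F1 {n : ℕ} (θ : Fin (n + 3) → ℂ) (i : Fin n) (t : Fin n → ℂ) : ℂ :=
  (∑ j, 2 / (2 * t i * t j - t i - t j) *
      (dl j (fun s => Chat θ i s + ChatStar θ i s) t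
        + (Chat θ i t - ChatStar θ i t) * (Chat θ j t - ChatStar θ j t)))
    - (th θ (ix0 n) / t i + th θ (ix1 n) / (t i - 1)) * (Chat θ i t - ChatStar θ i t)
    - (2 * t i - 1) / (t i * (t i - 1)) * Chat θ i t
    - th θ (ix i) ^ 2 / (4 * (t i * (t i - 1)))

end

end Schlesinger

namespace Schlesinger

noncomputable section

/-! Write `Ĥ_i` for `Hhat`, `R̂` for `Rhat` and `x_i = tr A_i R̂ - θ_i / 2` for `hamDiff`. Then `δ_i
log τ₀ = Ĥ_i - Ĉ_i`, and the effect of `T` on the Hamiltonians is simply `T(Ĥ_i) = Ĥ_i - x_i`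
(`Hhat_T`), so `δ_i log τ₁ = Ĥ_i - x_i - Ĉ*_i`. After division by `τ₀ τ₁` the Hirota derivatives
become logarithmic: `D*_i D*_j` yields `δ_i δ_j log (τ₀ τ₁)` plus the product of the `δ_i` and `δ_j`
of `log (τ₀ / τ₁)`. The coefficients `F` are chosen so that every `Ĉ` and `Ĉ*` cancels.

What is left is `reduced_identity`, a relation between `δ_j Ĥ_i`, `δ_j x_i`, `x_i x_j` and `Ĥ_i`.
Its derivatives are explicit. Along the Schlesinger flow `Ĥ_i` varies only through its explicit
dependence on the poles (`hasPd_sum_trace`), and `R̂` is the projector onto the image of `A_{n+1}`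
along the image of `A_{n+2}`, which determines its evolution (`hasMatPd_Rhat`).

With `q = 2 t_i t_j - t_i - t_j`, the weight `2 / q` is explained by `q² = 4 t_i (t_i - 1) t_j (t_j
- 1) + (t_i - t_j)²`. Together with the polarized Cayley–Hamilton identity this removes the
denominator `q` from each off-diagonal term (`reduced_term_of_ne`). The sums over `j ≠ i` then
cancel against the diagonal term, and only the contributions of the poles `0` and `1` and of `θ_i²`
survive. -/

/-- `f` is differentiable at `t` and its partial derivative `∂ f / ∂ t_k` there is `f'`. -/
def HasPd {n : ℕ} (k : Fin n) (f : (Fin n → ℂ) → ℂ) (f' : ℂ) (t : Fin n → ℂ) : Prop :=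
  DifferentiableAt ℂ f t ∧ pd k f t = f'

/-- The entrywise version of `HasPd` for matrix valued functions. -/
def HasMatPd {n : ℕ} (k : Fin n) (F : (Fin n → ℂ) → Mat2) (F' : Mat2) (t : Fin n → ℂ) : Prop :=
  ∀ a b, HasPd k (fun s => F s a b) (F' a b) t

/-! ### Calculus of partial derivatives -/

section Calculus

variable {n : ℕ} {k : Fin n} {t : Fin n → ℂ} {f g : (Fin n → ℂ) → ℂ} {f' g' : ℂ}
  {F G : (Fin n → ℂ) → Mat2} {F' G' : Mat2}

theorem HasPd.of_eq (hf : HasPd k f f' t) (h : f' = g') : HasPd k f g' t := h ▸ hf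

theorem HasPd.unique (hf : HasPd k f f' t) (hg : HasPd k f g' t) : f' = g' :=
  hf.2.symm.trans hg.2

theorem HasPd.congr (hf : HasPd k f f' t) (h : g =ᶠ[nhds t] f) : HasPd k g f' t :=
  ⟨hf.1.congr_of_eventuallyEq h, by rw [pd, h.fderiv_eq]; exact hf.2⟩

theorem HasPd.dl_eq (hf : HasPd k f f' t) : dl k f t = t k * (t k - 1) * f' := by
  rw [dl, hf.2]

theorem hasPd_const (c : ℂ) : HasPd k (fun _ => c) 0 t :=
  ⟨differentiableAt_const c, by simp [pd]⟩

theorem hasPd_coord (j : Fin n) : HasPd k (fun s => s j) (if j = k then 1 else 0) t := by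
  refine ⟨differentiableAt_apply j t, ?_⟩
  have : (fun s : Fin n → ℂ => s j) = ContinuousLinearMap.proj (R := ℂ) (φ := fun _ => ℂ) j := rfl
  rw [pd, this, ContinuousLinearMap.fderiv]
  simp [Pi.single_apply]

theorem HasPd.add (hf : HasPd k f f' t) (hg : HasPd k g g' t) :
    HasPd k (fun s => f s + g s) (f' + g') t :=
  ⟨hf.1.add hg.1, by rw [pd, fderiv_fun_add hf.1 hg.1, ← hf.2, ← hg.2]; rfl⟩

theorem HasPd.sub (hf : HasPd k f f' t) (hg : HasPd k g g' t) :
    HasPd k (fun s => f s - g s) (f' - g') t :=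
  ⟨hf.1.sub hg.1, by rw [pd, fderiv_fun_sub hf.1 hg.1, ← hf.2, ← hg.2]; rfl⟩

theorem HasPd.mul (hf : HasPd k f f' t) (hg : HasPd k g g' t) :
    HasPd k (fun s => f s * g s) (f' * g t + f t * g') t :=
  ⟨hf.1.mul hg.1, by
    rw [pd, fderiv_fun_mul hf.1 hg.1, ← hf.2, ← hg.2]
    simp [pd]
    ring⟩

theorem HasPd.const_mul (c : ℂ) (hf : HasPd k f f' t) :
    HasPd k (fun s => c * f s) (c * f') t :=
  ((hasPd_const c).mul hf).of_eq (by ring)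

theorem HasPd.inv (hf : HasPd k f f' t) (h : f t ≠ 0) :
    HasPd k (fun s => (f s)⁻¹) (-f' / f t ^ 2) t := by
  have h1 : HasFDerivAt (fun s => (f s)⁻¹) _ t := (hasDerivAt_inv h).comp_hasFDerivAt t hf.1.hasFDerivAt
  refine ⟨h1.differentiableAt, ?_⟩
  rw [pd, h1.fderiv, ← hf.2]
  simp [pd]
  ring

theorem HasPd.sum {ι : Type*} (s : Finset ι) {f : ι → (Fin n → ℂ) → ℂ} {f' : ι → ℂ}
    (h : ∀ j ∈ s, HasPd k (f j) (f' j) t) :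
    HasPd k (fun x => ∑ j ∈ s, f j x) (∑ j ∈ s, f' j) t := by
  classical
  induction s using Finset.induction_on with
  | empty => simpa using hasPd_const 0
  | insert a s ha ih =>
    simp only [Finset.sum_insert ha]
    exact (h a (by simp)).add (ih fun j hj => h j (by simp [hj]))

theorem HasMatPd.mul (hF : HasMatPd k F F' t) (hG : HasMatPd k G G' t) :
    HasMatPd k (fun s => F s * G s) (F' * G t + F t * G') t := by
  intro a b
  simp only [Matrix.mul_apply, Fin.sum_univ_two, Matrix.add_apply]
  exact (((hF a 0).mul (hG 0 b)).add ((hF a 1).mul (hG 1 b))).of_eq (by ring)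

theorem HasMatPd.trace (hF : HasMatPd k F F' t) :
    HasPd k (fun s => (F s).trace) F'.trace t := by
  simp only [Matrix.trace_fin_two]
  exact (hF 0 0).add (hF 1 1)

theorem HasMatPd.unique (hF : HasMatPd k F F' t) (hG : HasMatPd k F G' t) : F' = G' := by
  ext a b
  exact (hF a b).unique (hG a b)

theorem HasMatPd.congr (hF : HasMatPd k F F' t) (h : G =ᶠ[nhds t] F) : HasMatPd k G F' t :=
  fun a b => (hF a b).congr (h.mono fun s hs => by simp only [hs])

end Calculus

/-! ### The singular points and sums over them -/

section Points

variable {n : ℕ}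

@[simp] theorem pts_ix (t : Fin n → ℂ) (i : Fin n) : pts t (ix i) = t i := by
  simp [pts, ix]

@[simp] theorem pts_ix0 (t : Fin n → ℂ) : pts t (ix0 n) = 0 := by
  simp [pts, ix0]

@[simp] theorem pts_ix1 (t : Fin n → ℂ) : pts t (ix1 n) = 1 := by
  simp [pts, ix1]

theorem ix_injective : Function.Injective (ix (n := n)) := fun i j h => by
  simpa [ix] using h

@[simp] theorem ix_inj {i j : Fin n} : ix i = ix j ↔ i = j := ix_injective.eq_iff

@[simp] theorem ix0_ne_ix (i : Fin n) : ix0 n ≠ ix i := by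
  simp [ix0, ix, Fin.ext_iff]; omega

@[simp] theorem ix1_ne_ix (i : Fin n) : ix1 n ≠ ix i := by
  simp [ix1, ix, Fin.ext_iff]; omega

@[simp] theorem ix0_ne_ix1 : ix0 n ≠ ix1 n := by
  simp [ix0, ix1, Fin.ext_iff]

theorem sum_ne_ix {M : Type*} [AddCommMonoid M] (i : Fin n) (f : Fin (n + 2) → M) :
    ∑ j ∈ Finset.univ.filter (fun j => j ≠ ix i), f j =
      ∑ j ∈ Finset.univ.filter (fun j => j ≠ i), f (ix j) + f (ix0 n) + f (ix1 n) := by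
  have h0 := ix0_ne_ix i
  have h1 := ix1_ne_ix i
  rw [Finset.sum_filter, Finset.sum_filter, Fin.sum_univ_castSucc, Fin.sum_univ_castSucc]
  change ∑ j : Fin n, (if ix j ≠ ix i then f (ix j) else 0) +
    (if ix0 n ≠ ix i then f (ix0 n) else 0) + (if ix1 n ≠ ix i then f (ix1 n) else 0) = _
  simp

theorem hasPd_pts (k : Fin n) (j : Fin (n + 2)) (t : Fin n → ℂ) :
    HasPd k (fun s => pts s j) (if j = ix k then 1 else 0) t := by
  have : (∃ i, j = ix i) ∨ j = ix0 n ∨ j = ix1 n := by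
    induction j using Fin.lastCases with
    | last => exact Or.inr (Or.inr rfl)
    | cast j =>
      induction j using Fin.lastCases with
      | last => exact Or.inr (Or.inl rfl)
      | cast j => exact Or.inl ⟨j, rfl⟩
  rcases this with ⟨i, rfl⟩ | rfl | rfl
  · simpa using hasPd_coord (k := k) (t := t) i
  · simpa using hasPd_const (k := k) (t := t) 0
  · simpa using hasPd_const (k := k) (t := t) 1

theorem hasPd_sum_div (k i : Fin n) {t : Fin n → ℂ} (hp : Function.Injective (pts t))
    {w : Fin (n + 2) → (Fin n → ℂ) → ℂ} {w' : Fin (n + 2) → ℂ}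
    (hw : ∀ j, HasPd k (w j) (w' j) t) :
    HasPd k
      (fun s => ∑ j ∈ Finset.univ.filter (fun j => j ≠ ix i), 1 / (pts s (ix i) - pts s j) * w j s)
      (∑ j ∈ Finset.univ.filter (fun j => j ≠ ix i),
          ((if j = ix k then 1 else 0) - (if i = k then 1 else 0)) /
            (pts t (ix i) - pts t j) ^ 2 * w j t
        + ∑ j ∈ Finset.univ.filter (fun j => j ≠ ix i), 1 / (pts t (ix i) - pts t j) * w' j) t := by
  rw [← Finset.sum_add_distrib]
  refine HasPd.sum _ fun j hj => ?_
  have hne : pts t (ix i) - pts t j ≠ 0 :=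
    sub_ne_zero.mpr fun h => (Finset.mem_filter.mp hj).2 (hp h).symm
  simp only [one_div]
  refine ((((hasPd_pts k (ix i) t).sub (hasPd_pts k j t)).inv hne).mul (hw j)).of_eq ?_
  simp only [ix_inj]
  ring

/-- `∂_k` of `∑_{j ≠ i} w_j / (t_i - t_j)` when the variation of the `w_j` drops out. -/
theorem hasPd_sum_div_of_sum_eq_zero (k i : Fin n) {t : Fin n → ℂ}
    (hp : Function.Injective (pts t))
    {w : Fin (n + 2) → (Fin n → ℂ) → ℂ} {w' : Fin (n + 2) → ℂ}
    (hw : ∀ j, HasPd k (w j) (w' j) t)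
    (h0 : ∑ j ∈ Finset.univ.filter (fun j => j ≠ ix i), 1 / (pts t (ix i) - pts t j) * w' j = 0) :
    HasPd k
      (fun s => ∑ j ∈ Finset.univ.filter (fun j => j ≠ ix i), 1 / (pts s (ix i) - pts s j) * w j s)
      (if i = k then
        -∑ j ∈ Finset.univ.filter (fun j => j ≠ ix i), w j t / (pts t (ix i) - pts t j) ^ 2
      else w (ix k) t / (t i - t k) ^ 2) t := by
  refine (hasPd_sum_div k i hp hw).of_eq ?_
  rw [h0, add_zero]
  split_ifs with h
  · subst h
    rw [← Finset.sum_neg_distrib]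
    refine Finset.sum_congr rfl fun j hj => ?_
    rw [if_neg (Finset.mem_filter.mp hj).2]
    ring
  · rw [Finset.sum_eq_single (ix k)]
    · simp
      ring
    · intro j _ hj
      simp [hj]
    · intro hk
      simp at hk
      exact absurd hk.symm h

end Points

/-! ### Algebra of 2 × 2 matrices -/

section Matrices

theorem trace_mul_commutator (X Y Z : Mat2) :
    (X * (Y * Z - Z * Y)).trace = ((Z * X - X * Z) * Y).trace := by
  simp only [Matrix.trace_fin_two, Matrix.mul_apply, Fin.sum_univ_two, Matrix.sub_apply]
  ring

theorem trace_commutator_mul_left (X Y : Mat2) : ((X * Y - Y * X) * X).trace = 0 := by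
  simp only [Matrix.trace_fin_two, Matrix.mul_apply, Fin.sum_univ_two, Matrix.sub_apply]
  ring

theorem trace_commutator_mul_right (X Y : Mat2) : ((X * Y - Y * X) * Y).trace = 0 := by
  simp only [Matrix.trace_fin_two, Matrix.mul_apply, Fin.sum_univ_two, Matrix.sub_apply]
  ring

/-- The polarized Cayley–Hamilton identity for `2 × 2` matrices. -/
theorem trace_mul_mul_add_trace_mul_mul (X Y Z : Mat2) :
    (X * Y * Z).trace + (Y * X * Z).trace =
      X.trace * (Y * Z).trace + Y.trace * (X * Z).trace + Z.trace * (X * Y).trace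
        - X.trace * Y.trace * Z.trace := by
  simp only [Matrix.trace_fin_two, Matrix.mul_apply, Fin.sum_univ_two]
  ring

/-- A singular `X` has rank at most one, `X = u vᵀ`, so the middle factor `vᵀ Y u` is the scalar `tr
Y X`. -/
theorem mul_mul_self_of_det_eq_zero {X : Mat2} (h : X.det = 0) (Y : Mat2) :
    X * Y * X = (Y * X).trace • X := by
  rw [Matrix.det_fin_two] at h
  ext a b
  fin_cases a <;> fin_cases b <;>
    simp only [Matrix.trace_fin_two, Matrix.mul_apply, Fin.sum_univ_two, Matrix.smul_apply,
      smul_eq_mul, Fin.zero_eta, Fin.mk_one]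
  · linear_combination -Y 1 1 * h
  · linear_combination Y 0 1 * h
  · linear_combination Y 1 0 * h
  · linear_combination -Y 0 0 * h

theorem mul_self_of_det_eq_zero {X : Mat2} (h : X.det = 0) : X * X = X.trace • X := by
  simpa using mul_mul_self_of_det_eq_zero h 1

/-- The wedge is the determinant formed by the second columns of `A k` and `A l`. These columns span
the plane, so a matrix killing both vanishes. This is what makes the derivative of `R̂` computable
from its products with two residues. -/
theorem eq_zero_of_mul_eq_zero_of_wedge_ne_zero {m : ℕ} {A : Fin m → Mat2} {k l : Fin m}
    (hw : wedge A k l ≠ 0) {X : Mat2} (hk : X * A k = 0) (hl : X * A l = 0) : X = 0 := by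
  have e (a : Fin 2) : X a 0 * A k 0 1 + X a 1 * A k 1 1 = 0 := by
    simpa [Matrix.mul_apply, Fin.sum_univ_two] using congrFun (congrFun hk a) 1
  have f (a : Fin 2) : X a 0 * A l 0 1 + X a 1 * A l 1 1 = 0 := by
    simpa [Matrix.mul_apply, Fin.sum_univ_two] using congrFun (congrFun hl a) 1
  have z0 (a : Fin 2) : X a 0 = 0 := by
    refine (mul_eq_zero.mp ?_).resolve_right hw
    rw [wedge]
    linear_combination A l 1 1 * e a - A k 1 1 * f a
  have z1 (a : Fin 2) : X a 1 = 0 := by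
    refine (mul_eq_zero.mp ?_).resolve_right hw
    rw [wedge]
    linear_combination A k 0 1 * f a - A l 0 1 * e a
  ext a b
  fin_cases b
  · exact z0 a
  · exact z1 a

end Matrices

/-! ### Effect of the gauge transformation on the traces `tr A_i A_j` -/

section Gauge

variable {m : ℕ} (p : Fin m → ℂ) (A : Fin m → Mat2) (k l i : Fin m)

/-- The regular part at `p i` of the gauge transformation. -/
theorem T_gauge_regular (hp : Function.Injective p) (hkl : k ≠ l) (hik : i ≠ k) (hil : i ≠ l)
    (hk : (A k).det = 0) (hl : (A l).det = 0) (hw : wedge A k l ≠ 0) :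
    (∑ j ∈ Finset.univ.filter (fun j => j ≠ i), (1 / (p i - p j)) • T p A k l j) *
        ((p i - p l) • (1 : Mat2) + R p A k l) + T p A k l i =
      ((p i - p l) • (1 : Mat2) + R p A k l) *
        (∑ j ∈ Finset.univ.filter (fun j => j ≠ i), (1 / (p i - p j)) • A j) + A i + 1 := by
  obtain ⟨-, -, -, -, h5, -, -, -⟩ := R_relations p A k l hk hl hw
  have hqk : p i - p k ≠ 0 := sub_ne_zero.mpr fun h => hik (hp h)
  have hql : p i - p l ≠ 0 := sub_ne_zero.mpr fun h => hil (hp h)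
  have hMN : ((p i - p k) • (1 : Mat2) - R p A k l) * ((p i - p l) • (1 : Mat2) + R p A k l)
      = ((p i - p k) * (p i - p l)) • (1 : Mat2) := by
    simp only [sub_mul, mul_add, h5, smul_mul_assoc, mul_smul_comm, one_mul, mul_one]
    module
  -- Equality of the residues at `p i` on the two sides of the gauge equation; the simple poles
  -- therefore cancel.
  have hTi : T p A k l i * ((p i - p l) • (1 : Mat2) + R p A k l) =
      ((p i - p l) • (1 : Mat2) + R p A k l) * A i := by
    rw [T, if_neg hik, if_neg hil, smul_mul_assoc, mul_assoc (_ * A i), hMN, mul_smul_comm,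
      mul_one, smul_smul]
    convert one_smul ℂ _ using 2
    field_simp
  -- For `z ≠ p i` this is the gauge equation with its polar part removed. The isolated `T p A k l
  -- i` and `A i` come from the linear term `z - p i` of the gauge matrix multiplying the pole.
  have hev : ∀ᶠ z in nhdsWithin (p i) {p i}ᶜ,
      (∑ j ∈ Finset.univ.filter (fun j => j ≠ i), (1 / (z - p j)) • T p A k l j) *
        ((z - p l) • (1 : Mat2) + R p A k l) + T p A k l i =
      ((z - p l) • (1 : Mat2) + R p A k l) *
        (∑ j ∈ Finset.univ.filter (fun j => j ≠ i), (1 / (z - p j)) • A j) + A i + 1 := by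
    have hne : ∀ᶠ z in nhdsWithin (p i) {p i}ᶜ, ∀ j, z ≠ p j := by
      rw [Filter.eventually_all]
      intro j
      by_cases hj : j = i
      · subst hj
        exact self_mem_nhdsWithin
      · exact Filter.Eventually.filter_mono nhdsWithin_le_nhds
          (eventually_ne_nhds fun h => hj (hp h).symm)
    filter_upwards [hne] with z hz
    have hzi : z - p i ≠ 0 := sub_ne_zero.mpr (hz i)
    have h := T_gauge p A k l hp hkl hk hl hw z hz
    rw [← Finset.add_sum_erase _ _ (Finset.mem_univ i),
      ← Finset.add_sum_erase _ (fun j => (1 / (z - p j)) • A j) (Finset.mem_univ i),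
      ← Finset.filter_ne', add_mul _ _ ((z - p l) • (1 : Mat2) + R p A k l),
      mul_add ((z - p l) • (1 : Mat2) + R p A k l)] at h
    have hN : ((z - p l) • (1 : Mat2) + R p A k l) =
        (z - p i) • (1 : Mat2) + ((p i - p l) • (1 : Mat2) + R p A k l) := by
      module
    have e1 : (1 / (z - p i)) • T p A k l i * ((z - p l) • (1 : Mat2) + R p A k l) =
        T p A k l i + (1 / (z - p i)) • (((p i - p l) • (1 : Mat2) + R p A k l) * A i) := by
      rw [hN, mul_add, smul_mul_assoc, smul_mul_assoc, hTi, mul_smul_comm, mul_one, smul_smul,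
        one_div_mul_cancel hzi, one_smul]
    have e2 : ((z - p l) • (1 : Mat2) + R p A k l) * ((1 / (z - p i)) • A i) =
        A i + (1 / (z - p i)) • (((p i - p l) • (1 : Mat2) + R p A k l) * A i) := by
      rw [hN, add_mul, mul_smul_comm, mul_smul_comm, smul_mul_assoc, one_mul, smul_smul,
        one_div_mul_cancel hzi, one_smul]
    rw [e1, e2] at h
    rw [← sub_eq_zero] at h ⊢
    rw [← h]
    abel
  have hcont (B : Fin m → Mat2) : Filter.Tendsto
      (fun z => ∑ j ∈ Finset.univ.filter (fun j => j ≠ i), (1 / (z - p j)) • B j)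
      (nhdsWithin (p i) {p i}ᶜ)
      (nhds (∑ j ∈ Finset.univ.filter (fun j => j ≠ i), (1 / (p i - p j)) • B j)) := by
    refine tendsto_finsetSum _ fun j hj => ?_
    have hij : p i - p j ≠ 0 := sub_ne_zero.mpr fun h => (Finset.mem_filter.mp hj).2 (hp h).symm
    have : ContinuousAt (fun z => (1 / (z - p j)) • B j) (p i) :=
      ((continuousAt_const.div (continuousAt_id.sub continuousAt_const) hij).smul
        continuousAt_const)
    exact this.tendsto.mono_left nhdsWithin_le_nhds
  have hNc : Filter.Tendsto (fun z => (z - p l) • (1 : Mat2) + R p A k l)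
      (nhdsWithin (p i) {p i}ᶜ) (nhds ((p i - p l) • (1 : Mat2) + R p A k l)) := by
    have : Continuous (fun z => (z - p l) • (1 : Mat2) + R p A k l) := by fun_prop
    exact (this.tendsto (p i)).mono_left nhdsWithin_le_nhds
  -- Both sides are continuous at `p i`, so the identity on a punctured neighbourhood passes to the
  -- limit.
  exact tendsto_nhds_unique_of_eventuallyEq
    (((hcont _).mul hNc).add tendsto_const_nhds)
    (((hNc.mul (hcont A)).add tendsto_const_nhds).add tendsto_const_nhds) hev

/-- With `N` the gauge matrix at `p i`, `T(A_i) = N A_i N⁻¹`. Conjugating the regular part `B` of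
the transformed system back by `N` gives `N⁻¹ B N = A' + N⁻¹ (A_i + 1 - T(A_i))`, with `A'` the
original regular part. Paired with `A_i`, the terms in `A_i` and `T(A_i)` cancel because `N⁻¹ T(A_i)
= A_i N⁻¹`, and only `tr A_i N⁻¹` remains. -/
theorem trace_T_mul_sum (hp : Function.Injective p) (hkl : k ≠ l) (hik : i ≠ k) (hil : i ≠ l)
    (hk : (A k).det = 0) (hl : (A l).det = 0) (hw : wedge A k l ≠ 0) :
    ∑ j ∈ Finset.univ.filter (fun j => j ≠ i),
        1 / (p i - p j) * (T p A k l i * T p A k l j).trace =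
      ∑ j ∈ Finset.univ.filter (fun j => j ≠ i), 1 / (p i - p j) * (A i * A j).trace +
        ((p i - p k) * (A i).trace - (A i * R p A k l).trace) / ((p i - p k) * (p i - p l)) := by
  have hreg := T_gauge_regular p A k l i hp hkl hik hil hk hl hw
  obtain ⟨-, -, -, -, h5, -, -, -⟩ := R_relations p A k l hk hl hw
  have hqk : p i - p k ≠ 0 := sub_ne_zero.mpr fun h => hik (hp h)
  have hql : p i - p l ≠ 0 := sub_ne_zero.mpr fun h => hil (hp h)
  have hs (X : Mat2) (B : Fin m → Mat2) :
      ∑ j ∈ Finset.univ.filter (fun j => j ≠ i), 1 / (p i - p j) * (X * B j).trace =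
      (X * ∑ j ∈ Finset.univ.filter (fun j => j ≠ i), (1 / (p i - p j)) • B j).trace := by
    rw [Finset.mul_sum, Matrix.trace_sum]
    simp
  rw [hs, hs]
  have hT : T p A k l i = (1 / ((p i - p k) * (p i - p l))) •
      (((p i - p l) • (1 : Mat2) + R p A k l) * A i * ((p i - p k) • (1 : Mat2) - R p A k l)) := by
    rw [T, if_neg hik, if_neg hil]
  have hMN : ((p i - p k) • (1 : Mat2) - R p A k l) * ((p i - p l) • (1 : Mat2) + R p A k l)
      = ((p i - p k) * (p i - p l)) • (1 : Mat2) := by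
    simp only [sub_mul, mul_add, h5, smul_mul_assoc, mul_smul_comm, one_mul, mul_one]
    module
  have hM : (A i * ((p i - p k) • (1 : Mat2) - R p A k l)).trace =
      (p i - p k) * (A i).trace - (A i * R p A k l).trace := by
    simp [mul_sub]
  rw [← hM]
  generalize ∑ j ∈ Finset.univ.filter (fun j => j ≠ i), (1 / (p i - p j)) • T p A k l j = B at *
  generalize ∑ j ∈ Finset.univ.filter (fun j => j ≠ i), (1 / (p i - p j)) • A j = A' at *
  generalize T p A k l i = X at *
  generalize (p i - p l) • (1 : Mat2) + R p A k l = N at *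
  -- `M` is `N⁻¹` up to the scalar `q = (p i - p k) * (p i - p l)`.
  generalize (p i - p k) • (1 : Mat2) - R p A k l = M at *
  set q := (p i - p k) * (p i - p l) with hq
  have hq0 : q ≠ 0 := mul_ne_zero hqk hql
  have hBN : B * N = N * A' + A i + 1 - X := eq_sub_of_add_eq hreg
  have hMX : M * X = A i * M := by
    rw [hT, mul_smul_comm, ← mul_assoc, ← mul_assoc, hMN, smul_mul_assoc, one_mul,
      smul_mul_assoc, smul_smul, one_div_mul_cancel hq0, one_smul]
  have e : (N * A i * M * B).trace = q * (A i * A').trace + (A i * M).trace := by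
    rw [mul_assoc, mul_assoc, Matrix.trace_mul_comm, mul_assoc, mul_assoc, hBN]
    simp only [mul_add, mul_sub, mul_one, hMX, Matrix.trace_add, Matrix.trace_sub]
    rw [← mul_assoc M N, hMN, Matrix.trace_mul_comm (A i) (M * A i), mul_assoc M,
      Matrix.trace_mul_comm M, mul_assoc (A i)]
    simp
    ring
  conv_lhs => rw [hT, smul_mul_assoc, Matrix.trace_smul, e, smul_eq_mul]
  field_simp

end Gauge

/-! ### The Schlesinger system, one partial derivative at a time -/

section Evolution

variable {n : ℕ} {θ : Fin (n + 3) → ℂ} {U : Set (Fin n → ℂ)}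
  {A : (Fin n → ℂ) → Fin (n + 2) → Mat2} {t : Fin n → ℂ}

theorem IsSolution.hasMatPd_of_ne (hA : IsSolution θ U A) (hU : IsOpen U) (ht : t ∈ U)
    {k : Fin n} {j : Fin (n + 2)} (hj : j ≠ ix k) :
    HasMatPd k (fun s => A s j)
      ((1 / (t k - pts t j)) • (A t (ix k) * A t j - A t j * A t (ix k))) t := by
  intro a b
  refine ⟨(hA.holo j a b).differentiableAt (hU.mem_nhds ht), ?_⟩
  rw [hA.eqn t ht k j a b, Finset.sum_eq_single (ix k)]
  · rw [((hasPd_pts k j t).sub (hasPd_pts k (ix k) t)).2, if_neg hj, if_pos rfl, pts_ix,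
      Matrix.smul_apply, smul_eq_mul, ← neg_sub (t k), zero_sub, neg_div_neg_eq, mul_comm]
  · intro m _ hm
    rw [((hasPd_pts k j t).sub (hasPd_pts k m t)).2, if_neg hj, if_neg hm]
    simp
  · intro h
    simp at h
    exact absurd h.symm hj

theorem IsSolution.hasMatPd_self (hA : IsSolution θ U A) (hU : IsOpen U) (ht : t ∈ U)
    (k : Fin n) :
    HasMatPd k (fun s => A s (ix k))
      (∑ m ∈ Finset.univ.filter (fun m => m ≠ ix k),
        (1 / (t k - pts t m)) • (A t m * A t (ix k) - A t (ix k) * A t m)) t := by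
  intro a b
  refine ⟨(hA.holo _ a b).differentiableAt (hU.mem_nhds ht), ?_⟩
  rw [hA.eqn t ht k _ a b, Matrix.sum_apply]
  refine Finset.sum_congr rfl fun m hm => ?_
  rw [((hasPd_pts k (ix k) t).sub (hasPd_pts k m t)).2, if_neg (Finset.mem_filter.mp hm).2,
    if_pos rfl, pts_ix, Matrix.smul_apply, smul_eq_mul, sub_zero, mul_comm]

end Evolution

/-! ### The projector `R̂` and its evolution -/

section Projector

variable {n : ℕ} {θ : Fin (n + 3) → ℂ} {U : Set (Fin n → ℂ)}
  {A : (Fin n → ℂ) → Fin (n + 2) → Mat2} {t : Fin n → ℂ}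

/-- The matrix `R̂` of the gauge transformation `T_{n+1,n+2}`. -/
def Rhat (A : (Fin n → ℂ) → Fin (n + 2) → Mat2) (t : Fin n → ℂ) : Mat2 :=
  R (pts t) (A t) (ix0 n) (ix1 n)

theorem coord_ne_zero (hp : Function.Injective (pts t)) (k : Fin n) : t k ≠ 0 := fun h =>
  ix0_ne_ix k (hp (by simp [h]))

theorem coord_sub_one_ne_zero (hp : Function.Injective (pts t)) (k : Fin n) : t k - 1 ≠ 0 :=
  sub_ne_zero.mpr fun h => ix1_ne_ix k (hp (by simp [h]))

/-- `R̂` is the projector onto the image of `A_{n+1}` along the image of `A_{n+2}`. Each of these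
rank one residues acts on its own image as multiplication by its trace. -/
theorem Rhat_relations (hA : IsSolution θ U A) (ht : t ∈ U)
    (hw : wedge (A t) (ix0 n) (ix1 n) ≠ 0) :
    Rhat A t * A t (ix0 n) = A t (ix0 n) ∧ Rhat A t * A t (ix1 n) = 0 ∧
    A t (ix0 n) * Rhat A t = th θ (ix0 n) • Rhat A t ∧
    A t (ix1 n) * Rhat A t = th θ (ix1 n) • Rhat A t - th θ (ix1 n) • (1 : Mat2) + A t (ix1 n) ∧
    (Rhat A t).trace = 1 ∧ (Rhat A t).det = 0 := by
  obtain ⟨h1, h2, h3, h4, -, h6, h7, -⟩ :=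
    R_relations (pts t) (A t) (ix0 n) (ix1 n) (hA.det_eq t ht _) (hA.det_eq t ht _) hw
  simp only [Rstar, hA.trace_eq t ht, pts_ix0, pts_ix1] at h1 h2 h3 h4 h6 h7
  refine ⟨by simpa [Rhat] using h1, h2, h3, ?_, by simpa [Rhat] using h6, h7⟩
  rw [mul_add, mul_smul_comm, mul_one] at h4
  rw [Rhat, eq_sub_of_add_eq' h4]
  module

theorem differentiableAt_Rhat (hA : IsSolution θ U A) (hU : IsOpen U) (ht : t ∈ U)
    (hw : wedge (A t) (ix0 n) (ix1 n) ≠ 0) (a b : Fin 2) :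
    DifferentiableAt ℂ (fun s => Rhat A s a b) t := by
  have hd (j : Fin (n + 2)) (a b : Fin 2) : DifferentiableAt ℂ (fun s => A s j a b) t :=
    (hA.holo j a b).differentiableAt (hU.mem_nhds ht)
  -- The constant `0 - 1` is `p k - p l` for the poles `0` and `1`.
  have hwd : DifferentiableAt ℂ (fun s => (0 - 1) / wedge (A s) (ix0 n) (ix1 n)) t := by
    have hwe : DifferentiableAt ℂ (fun s => wedge (A s) (ix0 n) (ix1 n)) t :=
      ((hd _ 0 1).mul (hd _ 1 1)).sub ((hd _ 1 1).mul (hd _ 0 1))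
    simpa only [div_eq_mul_inv] using (DifferentiableAt.fun_inv hwe hw).const_mul (0 - 1)
  simp only [Rhat, R, pts_ix0, pts_ix1, Matrix.smul_apply, Matrix.vecMulVec_apply, smul_eq_mul]
  fin_cases a <;> fin_cases b
  · exact hwd.mul ((hd _ 0 1).mul (hd _ 1 1).neg)
  · exact hwd.mul ((hd _ 0 1).mul (hd _ 0 1))
  · exact hwd.mul ((hd _ 1 1).mul (hd _ 1 1).neg)
  · exact hwd.mul ((hd _ 1 1).mul (hd _ 0 1))

/-- The relations `R̂ A_{n+1} = A_{n+1}` and `R̂ A_{n+2} = 0` hold on all of `U`. Differentiating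
them gives the products of the derivative with both residues, and these determine it since the wedge
is nonzero. -/
theorem hasMatPd_Rhat (hA : IsSolution θ U A) (hU : IsOpen U) (ht : t ∈ U)
    (hp : Function.Injective (pts t))
    (hgen : ∀ t ∈ U, wedge (A t) (ix0 n) (ix1 n) ≠ 0) (k : Fin n) :
    HasMatPd k (Rhat A)
      ((1 / t k) • (A t (ix k) * Rhat A t) - (1 / (t k - 1)) • (Rhat A t * A t (ix k))
        + ((A t (ix k) * Rhat A t).trace / (t k * (t k - 1))) • Rhat A t) t := by
  have h0 := coord_ne_zero hp k
  have h1 := coord_sub_one_ne_zero hp k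
  obtain ⟨r0, r1, -, -, -, rd⟩ := Rhat_relations hA ht (hgen t ht)
  set D : Mat2 := Matrix.of fun a b => pd k (fun s => Rhat A s a b) t with hD
  have hPD : HasMatPd k (Rhat A) D t := fun a b =>
    ⟨differentiableAt_Rhat hA hU ht (hgen t ht) a b, rfl⟩
  have hA0 := hA.hasMatPd_of_ne hU ht (ix0_ne_ix k)
  have hA1 := hA.hasMatPd_of_ne hU ht (ix1_ne_ix k)
  rw [pts_ix0, sub_zero] at hA0
  rw [pts_ix1] at hA1
  have e0 := ((hPD.mul hA0).congr (G := fun s => A s (ix0 n))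
    ((hU.mem_nhds ht |> Filter.Eventually.mono <| fun s hs =>
      (Rhat_relations hA hs (hgen s hs)).1.symm))).unique hA0
  have hz : HasMatPd k (fun s => Rhat A s * A s (ix1 n)) 0 t :=
    HasMatPd.congr (F := fun _ => 0) (fun a b => hasPd_const 0)
      (hU.mem_nhds ht |> Filter.Eventually.mono <| fun s hs =>
        (Rhat_relations hA hs (hgen s hs)).2.1)
  have e1 := (hPD.mul hA1).unique hz
  have hPXP := mul_mul_self_of_det_eq_zero rd (A t (ix k))
  convert hPD using 1
  rw [eq_comm, ← sub_eq_zero]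
  refine eq_zero_of_mul_eq_zero_of_wedge_ne_zero (hgen t ht) ?_ ?_
  -- Inserting `A_{n+1} = R̂ A_{n+1}` turns the product into `R̂ A_k R̂ A_{n+1}`, where `R̂ A_k R̂`
  -- is a multiple of `R̂`.
  · have hXA : Rhat A t * A t (ix k) * A t (ix0 n) =
        (A t (ix k) * Rhat A t).trace • A t (ix0 n) := by
      conv_lhs => rw [← r0, ← mul_assoc, hPXP, smul_mul_assoc, r0]
    rw [sub_mul D, eq_sub_of_add_eq e0]
    simp only [add_mul, sub_mul, mul_sub, smul_mul_assoc, mul_smul_comm, mul_assoc, r0]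
    simp only [← mul_assoc, hXA, r0]
    match_scalars <;> field_simp <;> ring
  · rw [sub_mul D, eq_neg_of_add_eq_zero_left e1]
    simp only [add_mul, sub_mul, mul_sub, smul_mul_assoc, mul_smul_comm, mul_assoc, r1, mul_zero,
      smul_zero]
    simp only [← mul_assoc, r1, zero_mul]
    module

theorem hasPd_trace_mul_Rhat_of_ne (hA : IsSolution θ U A) (hU : IsOpen U) (ht : t ∈ U)
    (hp : Function.Injective (pts t))
    (hgen : ∀ t ∈ U, wedge (A t) (ix0 n) (ix1 n) ≠ 0) {i k : Fin n} (hik : i ≠ k) :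
    HasPd k (fun s => (A s (ix i) * Rhat A s).trace)
      (((t k * (t i - 1) * (A t (ix k) * A t (ix i) * Rhat A t).trace
          - t i * (t k - 1) * (A t (ix i) * A t (ix k) * Rhat A t).trace) / (t k - t i)
        + (A t (ix i) * Rhat A t).trace * (A t (ix k) * Rhat A t).trace) /
          (t k * (t k - 1))) t := by
  have h0 := coord_ne_zero hp k
  have h1 := coord_sub_one_ne_zero hp k
  have hki : t k - t i ≠ 0 := sub_ne_zero.mpr fun h => hik (ix_injective (hp (by simp [h])))
  refine ((hA.hasMatPd_of_ne hU ht (ix_injective.ne hik)).mul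
    (hasMatPd_Rhat hA hU ht hp hgen k)).trace.of_eq ?_
  have hc : (A t (ix i) * (Rhat A t * A t (ix k))).trace =
      (A t (ix k) * A t (ix i) * Rhat A t).trace := by
    rw [← mul_assoc, Matrix.trace_mul_comm, mul_assoc]
  simp only [pts_ix, smul_mul_assoc, mul_smul_comm, Matrix.trace_add, Matrix.trace_smul, mul_add,
    mul_sub, sub_mul, Matrix.trace_sub, smul_eq_mul, hc, ← mul_assoc (A t (ix i)) (A t (ix k))]
  field_simp
  ring

theorem hasPd_trace_mul_Rhat_self (hA : IsSolution θ U A) (hU : IsOpen U) (ht : t ∈ U)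
    (hp : Function.Injective (pts t))
    (hgen : ∀ t ∈ U, wedge (A t) (ix0 n) (ix1 n) ≠ 0) (k : Fin n) :
    HasPd k (fun s => (A s (ix k) * Rhat A s).trace)
      (∑ m ∈ Finset.univ.filter (fun m => m ≠ ix k), 1 / (t k - pts t m) *
          ((A t m * A t (ix k) - A t (ix k) * A t m) * Rhat A t).trace
        + ((A t (ix k) * Rhat A t).trace ^ 2 - th θ (ix k) * (A t (ix k) * Rhat A t).trace) /
          (t k * (t k - 1))) t := by
  have h0 := coord_ne_zero hp k
  have h1 := coord_sub_one_ne_zero hp k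
  refine ((hA.hasMatPd_self hU ht k).mul (hasMatPd_Rhat hA hU ht hp hgen k)).trace.of_eq ?_
  have hsq := mul_self_of_det_eq_zero (hA.det_eq t ht (ix k))
  rw [hA.trace_eq t ht] at hsq
  have hc : (A t (ix k) * (Rhat A t * A t (ix k))).trace =
      th θ (ix k) * (A t (ix k) * Rhat A t).trace := by
    rw [← mul_assoc, Matrix.trace_mul_comm, ← mul_assoc, hsq]
    simp
  have hc' : (A t (ix k) * (A t (ix k) * Rhat A t)).trace =
      th θ (ix k) * (A t (ix k) * Rhat A t).trace := by
    rw [← mul_assoc, hsq]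
    simp
  rw [Matrix.trace_add, Finset.sum_mul, Matrix.trace_sum]
  simp only [smul_mul_assoc, mul_smul_comm, Matrix.trace_add, Matrix.trace_smul, mul_add,
    mul_sub, Matrix.trace_sub, smul_eq_mul, hc, hc']
  congr 1
  field_simp
  ring

end Projector

/-! ### Derivatives of the Hamiltonians along the flow -/

section Hamiltonian

variable {n : ℕ} {θ : Fin (n + 3) → ℂ} {U : Set (Fin n → ℂ)}
  {A : (Fin n → ℂ) → Fin (n + 2) → Mat2} {t : Fin n → ℂ}

/-- `∂_k ∑_{j ≠ i} (tr A_i A_j + c_j) / (t_i - t_j)`: only the explicit dependence on the poles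
contributes. -/
theorem hasPd_sum_trace (hA : IsSolution θ U A) (hU : IsOpen U) (ht : t ∈ U)
    (hp : Function.Injective (pts t)) (c : Fin (n + 2) → ℂ) (k i : Fin n) :
    HasPd k
      (fun s => ∑ j ∈ Finset.univ.filter (fun j => j ≠ ix i),
        1 / (pts s (ix i) - pts s j) * ((A s (ix i) * A s j).trace + c j))
      (if i = k then
        -∑ j ∈ Finset.univ.filter (fun j => j ≠ ix i),
          ((A t (ix i) * A t j).trace + c j) / (pts t (ix i) - pts t j) ^ 2
      else ((A t (ix i) * A t (ix k)).trace + c (ix k)) / (t i - t k) ^ 2) t := by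
  set D : Fin (n + 2) → Mat2 := fun j =>
    if j = ix k then
      ∑ m ∈ Finset.univ.filter (fun m => m ≠ ix k),
        (1 / (t k - pts t m)) • (A t m * A t (ix k) - A t (ix k) * A t m)
    else (1 / (t k - pts t j)) • (A t (ix k) * A t j - A t j * A t (ix k)) with hD
  have hAD (j) : HasMatPd k (fun s => A s j) (D j) t := by
    by_cases hj : j = ix k
    · subst hj
      simpa [hD] using hA.hasMatPd_self hU ht k
    · simpa [hD, hj] using hA.hasMatPd_of_ne hU ht hj
  have hw (j) := (((hAD (ix i)).mul (hAD j)).trace.add (hasPd_const (c j)))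
  -- It remains to see that the variations of the traces `tr A_i A_j`, weighted by `1 / (t_i -
  -- t_j)`, sum to zero.
  refine hasPd_sum_div_of_sum_eq_zero k i hp hw ?_
  have hsub {a b : Fin (n + 2)} (h : a ≠ b) : pts t a - pts t b ≠ 0 :=
    sub_ne_zero.mpr fun e => h (hp e)
  by_cases hik : i = k
  · subst hik
    set S := Finset.univ.filter (fun j => j ≠ ix i) with hS
    have hterm : ∀ j ∈ S, 1 / (pts t (ix i) - pts t j) *
        ((D (ix i) * A t j + A t (ix i) * D j).trace + 0) =
        ∑ m ∈ S, 1 / (t i - pts t j) * (1 / (t i - pts t m)) *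
          ((A t m * A t (ix i) - A t (ix i) * A t m) * A t j).trace := by
      intro j hj
      have hji : j ≠ ix i := (Finset.mem_filter.mp hj).2
      simp only [hD, if_neg hji, if_true, pts_ix, add_zero, Matrix.trace_add, mul_smul_comm,
        Matrix.trace_smul, trace_mul_commutator, trace_commutator_mul_right, smul_zero]
      rw [Finset.sum_mul, Matrix.trace_sum, Finset.mul_sum]
      refine Finset.sum_congr rfl fun m _ => ?_
      rw [smul_mul_assoc, Matrix.trace_smul, smul_eq_mul]
      ring
    rw [Finset.sum_congr rfl hterm]
    -- The weights are symmetric in `j` and `m`, whereas `tr [A_m, A_i] A_j` is antisymmetric, so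
    -- the double sum equals its own negative.
    have hanti : ∑ j ∈ S, ∑ m ∈ S, 1 / (t i - pts t j) * (1 / (t i - pts t m)) *
          ((A t m * A t (ix i) - A t (ix i) * A t m) * A t j).trace =
        -∑ j ∈ S, ∑ m ∈ S, 1 / (t i - pts t j) * (1 / (t i - pts t m)) *
          ((A t m * A t (ix i) - A t (ix i) * A t m) * A t j).trace := by
      conv_lhs => rw [Finset.sum_comm]
      rw [← Finset.sum_neg_distrib]
      refine Finset.sum_congr rfl fun j _ => ?_
      rw [← Finset.sum_neg_distrib]
      refine Finset.sum_congr rfl fun m _ => ?_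
      have : ((A t j * A t (ix i) - A t (ix i) * A t j) * A t m).trace =
          -((A t m * A t (ix i) - A t (ix i) * A t m) * A t j).trace := by
        simp only [Matrix.trace_fin_two, Matrix.mul_apply, Fin.sum_univ_two, Matrix.sub_apply]
        ring
      rw [this]
      ring
    exact self_eq_neg.mp hanti
  · have hne : ix i ≠ ix k := ix_injective.ne hik
    have hkmem : ix k ∈ Finset.univ.filter (fun j => j ≠ ix i) := by simp [Ne.symm hik]
    have himem : ix i ∈ Finset.univ.filter (fun j => j ≠ ix k) := by simp [hik]
    rw [← Finset.add_sum_erase _ _ hkmem]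
    set S := (Finset.univ.filter (fun j => j ≠ ix i)).erase (ix k) with hS
    have hS' : (Finset.univ.filter (fun j => j ≠ ix k)).erase (ix i) = S := by
      ext j
      simp [hS, and_comm]
    have hki : t k - t i ≠ 0 := by simpa using hsub hne.symm
    have hik' : t i - t k ≠ 0 := by simpa using hsub hne
    -- Partial fractions: `1 / (t_k - t_i) - 1 / (t_k - t_j)` has numerator `t_i - t_j`, which
    -- cancels the weight.
    have hterm : ∀ j ∈ S, 1 / (pts t (ix i) - pts t j) *
        ((D (ix i) * A t j + A t (ix i) * D j).trace + 0) =
        1 / (t k - t i) * (1 / (t k - pts t j) *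
          ((A t (ix k) * A t (ix i) - A t (ix i) * A t (ix k)) * A t j).trace) := by
      intro j hj
      have hj' : j ≠ ix k ∧ j ≠ ix i := by simpa [hS] using hj
      have h1 : t k - pts t j ≠ 0 := by simpa using hsub hj'.1.symm
      have h2 : t i - pts t j ≠ 0 := by simpa using hsub hj'.2.symm
      have e : (A t (ix i) * (A t (ix k) * A t j - A t j * A t (ix k))).trace =
          -((A t (ix k) * A t (ix i) - A t (ix i) * A t (ix k)) * A t j).trace := by
        simp only [Matrix.trace_fin_two, Matrix.mul_apply, Fin.sum_univ_two, Matrix.sub_apply]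
        ring
      simp only [hD, if_neg hj'.1, if_neg hne, pts_ix, add_zero, Matrix.trace_add, mul_smul_comm,
        smul_mul_assoc, Matrix.trace_smul, e, smul_eq_mul]
      field_simp
      ring
    rw [Finset.sum_congr rfl hterm]
    -- The term `j = k` carries the same sum, but with the weight `1 / (t_i - t_k)` instead of `1 /
    -- (t_k - t_i)`; the two contributions are opposite.
    have hk : (D (ix i) * A t (ix k) + A t (ix i) * D (ix k)).trace =
        ∑ j ∈ S, 1 / (t k - pts t j) *
          ((A t (ix k) * A t (ix i) - A t (ix i) * A t (ix k)) * A t j).trace := by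
      simp only [hD, if_neg hne, if_true, smul_mul_assoc, Matrix.trace_add, Matrix.trace_smul,
        trace_commutator_mul_left, smul_zero, zero_add]
      rw [Finset.mul_sum, Matrix.trace_sum, ← Finset.add_sum_erase _ _ himem, hS',
        mul_smul_comm, Matrix.trace_smul, trace_mul_commutator, trace_commutator_mul_right,
        smul_zero, zero_add]
      refine Finset.sum_congr rfl fun j _ => ?_
      rw [mul_smul_comm, Matrix.trace_smul, trace_mul_commutator, smul_eq_mul]
    rw [hk, ← Finset.mul_sum, pts_ix, pts_ix]
    generalize ∑ j ∈ S, 1 / (t k - pts t j) *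
          ((A t (ix k) * A t (ix i) - A t (ix i) * A t (ix k)) * A t j).trace = σ
    field_simp
    ring

end Hamiltonian

/-! ### The derivations `δ_k` on `Ĥ_i`, `Ĉ_i` and `x_i` -/

section Hhat

variable {n : ℕ} {θ : Fin (n + 3) → ℂ} {U : Set (Fin n → ℂ)}
  {A : (Fin n → ℂ) → Fin (n + 2) → Mat2} {t : Fin n → ℂ}

/-- `tr A_i A_j - θ_i θ_j / 2`. -/
def pairing (θ : Fin (n + 3) → ℂ) (A : Fin (n + 2) → Mat2) (i j : Fin (n + 2)) : ℂ :=
  (A i * A j).trace + -(1 / 2 * th θ i * th θ j)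

/-- `Ĥ_i = ∑_{j ≠ i} t_i (t_i - 1) / (t_i - t_j) * (tr A_i A_j - θ_i θ_j / 2)`. -/
def Hhat (θ : Fin (n + 3) → ℂ) (A : (Fin n → ℂ) → Fin (n + 2) → Mat2) (i : Fin n)
    (t : Fin n → ℂ) : ℂ :=
  t i * (t i - 1) * ∑ j ∈ Finset.univ.filter (fun j => j ≠ ix i),
    1 / (pts t (ix i) - pts t j) * pairing θ (A t) (ix i) j

/-- `x_i = tr A_i R̂ - θ_i / 2 = Ĥ_i - T(Ĥ_i)`. -/
def hamDiff (θ : Fin (n + 3) → ℂ) (A : (Fin n → ℂ) → Fin (n + 2) → Mat2) (i : Fin n)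
    (t : Fin n → ℂ) : ℂ :=
  (A t (ix i) * Rhat A t).trace - th θ (ix i) / 2

theorem coord_sub_ne_zero (hp : Function.Injective (pts t)) {i k : Fin n} (hik : i ≠ k) :
    t i - t k ≠ 0 :=
  sub_ne_zero.mpr fun h => hik (ix_injective (hp (by simp [h])))

theorem hasPd_coord_mul_sub_one (k i : Fin n) :
    HasPd k (fun s => s i * (s i - 1)) (if i = k then 2 * t i - 1 else 0) t :=
  ((hasPd_coord i).mul ((hasPd_coord i).sub (hasPd_const 1))).of_eq (by split_ifs <;> ring)

theorem hasPd_Hhat (hA : IsSolution θ U A) (hU : IsOpen U) (ht : t ∈ U)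
    (hp : Function.Injective (pts t)) (k i : Fin n) :
    HasPd k (Hhat θ A i)
      ((if i = k then 2 * t i - 1 else 0) *
          (∑ j ∈ Finset.univ.filter (fun j => j ≠ ix i),
            1 / (pts t (ix i) - pts t j) * pairing θ (A t) (ix i) j)
        + t i * (t i - 1) * (if i = k then
        -∑ j ∈ Finset.univ.filter (fun j => j ≠ ix i),
          pairing θ (A t) (ix i) j / (pts t (ix i) - pts t j) ^ 2
      else pairing θ (A t) (ix i) (ix k) / (t i - t k) ^ 2)) t :=
  (hasPd_coord_mul_sub_one k i).mul
    (hasPd_sum_trace hA hU ht hp (fun j => -(1 / 2 * th θ (ix i) * th θ j)) k i)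

theorem dl_Hhat_of_ne (hA : IsSolution θ U A) (hU : IsOpen U) (ht : t ∈ U)
    (hp : Function.Injective (pts t)) {k i : Fin n} (hik : i ≠ k) :
    dl k (Hhat θ A i) t = t i * (t i - 1) * (t k * (t k - 1)) / (t i - t k) ^ 2 *
      pairing θ (A t) (ix i) (ix k) := by
  rw [(hasPd_Hhat hA hU ht hp k i).dl_eq, if_neg hik, if_neg hik]
  ring

theorem dl_Hhat_self (hA : IsSolution θ U A) (hU : IsOpen U) (ht : t ∈ U)
    (hp : Function.Injective (pts t)) (i : Fin n) :
    dl i (Hhat θ A i) t = t i * (t i - 1) * (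
      (2 * t i - 1) * (∑ j ∈ Finset.univ.filter (fun j => j ≠ ix i),
            1 / (pts t (ix i) - pts t j) * pairing θ (A t) (ix i) j)
      - t i * (t i - 1) * ∑ j ∈ Finset.univ.filter (fun j => j ≠ ix i),
          pairing θ (A t) (ix i) j / (pts t (ix i) - pts t j) ^ 2) := by
  rw [(hasPd_Hhat hA hU ht hp i i).dl_eq, if_pos rfl, if_pos rfl]
  ring

theorem pairing_comm (θ : Fin (n + 3) → ℂ) (A : Fin (n + 2) → Mat2) (i j : Fin (n + 2)) :
    pairing θ A i j = pairing θ A j i := by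
  rw [pairing, pairing, Matrix.trace_mul_comm]
  ring

/-- This symmetry, with its analogues for `Chat` and `hamDiff`, exchanges the `δ_i` of the `j`-th
logarithmic derivative, which `D*_i D*_j` produces, for the `δ_j` of the `i`-th. -/
theorem dl_Hhat_comm (hA : IsSolution θ U A) (hU : IsOpen U) (ht : t ∈ U)
    (hp : Function.Injective (pts t)) (k i : Fin n) :
    dl k (Hhat θ A i) t = dl i (Hhat θ A k) t := by
  rcases eq_or_ne i k with rfl | hik
  · rfl
  · rw [dl_Hhat_of_ne hA hU ht hp hik, dl_Hhat_of_ne hA hU ht hp hik.symm,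
      pairing_comm θ (A t) (ix k) (ix i), ← neg_sub (t i), neg_sq]
    ring

theorem Chat_eq (θ : Fin (n + 3) → ℂ) (i : Fin n) (t : Fin n → ℂ) :
    Chat θ i t = -1 * (t i * (t i - 1) * ∑ j ∈ Finset.univ.filter (fun j => j ≠ ix i),
      1 / (pts t (ix i) - pts t j) * (C θ (ix i) j + 1 / 2 * th θ (ix i) * th θ j)) := by
  rw [Chat, neg_one_mul, Finset.mul_sum]
  congr 1
  exact Finset.sum_congr rfl fun j _ => by ring

theorem C_comm (θ : Fin (n + 3) → ℂ) (i j : Fin (n + 2)) : C θ i j = C θ j i := by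
  rw [C, C]
  ring

theorem hasPd_Chat (θ : Fin (n + 3) → ℂ) (hp : Function.Injective (pts t)) (k i : Fin n) :
    HasPd k (Chat θ i) (-1 * ((if i = k then 2 * t i - 1 else 0) *
          (∑ j ∈ Finset.univ.filter (fun j => j ≠ ix i), 1 / (pts t (ix i) - pts t j) *
            (C θ (ix i) j + 1 / 2 * th θ (ix i) * th θ j))
        + t i * (t i - 1) * (if i = k then
        -∑ j ∈ Finset.univ.filter (fun j => j ≠ ix i),
          (C θ (ix i) j + 1 / 2 * th θ (ix i) * th θ j) / (pts t (ix i) - pts t j) ^ 2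
      else (C θ (ix i) (ix k) + 1 / 2 * th θ (ix i) * th θ (ix k)) / (t i - t k) ^ 2))) t := by
  rw [funext (Chat_eq θ i)]
  exact ((hasPd_coord_mul_sub_one k i).mul (hasPd_sum_div_of_sum_eq_zero k i hp
    (fun j => hasPd_const (C θ (ix i) j + 1 / 2 * th θ (ix i) * th θ j)) (by simp))).const_mul (-1)

theorem differentiableAt_Chat (θ : Fin (n + 3) → ℂ) (hp : Function.Injective (pts t))
    (i : Fin n) : DifferentiableAt ℂ (Chat θ i) t :=
  (hasPd_Chat θ hp i i).1

theorem dl_Chat_comm (θ : Fin (n + 3) → ℂ) (hp : Function.Injective (pts t)) (k i : Fin n) :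
    dl k (Chat θ i) t = dl i (Chat θ k) t := by
  rcases eq_or_ne i k with rfl | hik
  · rfl
  · rw [(hasPd_Chat θ hp k i).dl_eq, (hasPd_Chat θ hp i k).dl_eq, if_neg hik, if_neg hik,
      if_neg hik.symm, if_neg hik.symm, C_comm θ (ix k) (ix i), ← neg_sub (t i), neg_sq]
    ring

theorem dl_hamDiff_of_ne (hA : IsSolution θ U A) (hU : IsOpen U) (ht : t ∈ U)
    (hp : Function.Injective (pts t))
    (hgen : ∀ t ∈ U, wedge (A t) (ix0 n) (ix1 n) ≠ 0) {k i : Fin n} (hik : i ≠ k) :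
    dl k (hamDiff θ A i) t =
      (t k * (t i - 1) * (A t (ix k) * A t (ix i) * Rhat A t).trace
          - t i * (t k - 1) * (A t (ix i) * A t (ix k) * Rhat A t).trace) / (t k - t i)
        + (A t (ix i) * Rhat A t).trace * (A t (ix k) * Rhat A t).trace := by
  have h0 := coord_ne_zero hp k
  have h1 := coord_sub_one_ne_zero hp k
  have h : HasPd k (hamDiff θ A i) _ t := (hasPd_trace_mul_Rhat_of_ne hA hU ht hp hgen hik).sub
    (hasPd_const (th θ (ix i) / 2))
  rw [h.dl_eq, sub_zero,
    mul_div_cancel₀ _ (mul_ne_zero h0 h1)]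

theorem dl_hamDiff_self (hA : IsSolution θ U A) (hU : IsOpen U) (ht : t ∈ U)
    (hp : Function.Injective (pts t))
    (hgen : ∀ t ∈ U, wedge (A t) (ix0 n) (ix1 n) ≠ 0) (i : Fin n) :
    dl i (hamDiff θ A i) t =
      t i * (t i - 1) * ∑ m ∈ Finset.univ.filter (fun m => m ≠ ix i), 1 / (t i - pts t m) *
          ((A t m * A t (ix i) - A t (ix i) * A t m) * Rhat A t).trace
        + ((A t (ix i) * Rhat A t).trace ^ 2 - th θ (ix i) * (A t (ix i) * Rhat A t).trace) := by
  have h0 := coord_ne_zero hp i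
  have h1 := coord_sub_one_ne_zero hp i
  have h : HasPd i (hamDiff θ A i) _ t := (hasPd_trace_mul_Rhat_self hA hU ht hp hgen i).sub
    (hasPd_const (th θ (ix i) / 2))
  rw [h.dl_eq, sub_zero, mul_add,
    mul_div_cancel₀ _ (mul_ne_zero h0 h1)]

theorem differentiableAt_hamDiff (hA : IsSolution θ U A) (hU : IsOpen U) (ht : t ∈ U)
    (hp : Function.Injective (pts t))
    (hgen : ∀ t ∈ U, wedge (A t) (ix0 n) (ix1 n) ≠ 0) (i : Fin n) :
    DifferentiableAt ℂ (hamDiff θ A i) t :=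
  ((hasPd_trace_mul_Rhat_self hA hU ht hp hgen i).sub (hasPd_const (th θ (ix i) / 2))).1

theorem dl_hamDiff_comm (hA : IsSolution θ U A) (hU : IsOpen U) (ht : t ∈ U)
    (hp : Function.Injective (pts t))
    (hgen : ∀ t ∈ U, wedge (A t) (ix0 n) (ix1 n) ≠ 0) (k i : Fin n) :
    dl k (hamDiff θ A i) t = dl i (hamDiff θ A k) t := by
  rcases eq_or_ne i k with rfl | hik
  · rfl
  · rw [dl_hamDiff_of_ne hA hU ht hp hgen hik, dl_hamDiff_of_ne hA hU ht hp hgen hik.symm]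
    have h1 := coord_sub_ne_zero hp hik
    have h2 := coord_sub_ne_zero hp hik.symm
    field_simp
    ring

end Hhat

/-! ### Logarithmic derivatives of the two τ-functions -/

section Tau

variable {n : ℕ} {θ : Fin (n + 3) → ℂ} {U : Set (Fin n → ℂ)}
  {A : (Fin n → ℂ) → Fin (n + 2) → Mat2} {t : Fin n → ℂ}

theorem dl_add {k : Fin n} {f g : (Fin n → ℂ) → ℂ} (hf : DifferentiableAt ℂ f t)
    (hg : DifferentiableAt ℂ g t) : dl k (fun s => f s + g s) t = dl k f t + dl k g t := by
  rw [dl, dl, dl, (HasPd.add ⟨hf, rfl⟩ ⟨hg, rfl⟩).2, mul_add]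

theorem dl_sub {k : Fin n} {f g : (Fin n → ℂ) → ℂ} (hf : DifferentiableAt ℂ f t)
    (hg : DifferentiableAt ℂ g t) : dl k (fun s => f s - g s) t = dl k f t - dl k g t := by
  rw [dl, dl, dl, (HasPd.sub ⟨hf, rfl⟩ ⟨hg, rfl⟩).2, mul_sub]

theorem dl_dl_of_dl_eq_mul (hU : IsOpen U) (ht : t ∈ U) {τ : (Fin n → ℂ) → ℂ}
    {a : Fin n → (Fin n → ℂ) → ℂ} (hτ : DifferentiableOn ℂ τ U)
    (h : ∀ s ∈ U, ∀ j, dl j τ s = a j s * τ s) (i j : Fin n)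
    (ha : DifferentiableAt ℂ (a j) t) :
    dl i (dl j τ) t = (dl i (a j) t + a i t * a j t) * τ t := by
  have h1 : HasPd i (fun s => a j s * τ s) _ t :=
    HasPd.mul ⟨ha, rfl⟩ ⟨hτ.differentiableAt (hU.mem_nhds ht), rfl⟩
  have h2 : HasPd i (dl j τ) _ t :=
    h1.congr ((hU.mem_nhds ht |> Filter.Eventually.mono <| fun s hs => h s hs j))
  have h3 := h t ht i
  rw [h2.dl_eq]
  simp only [dl] at h3 ⊢
  linear_combination a j t * h3

theorem mul_H_eq (θ : Fin (n + 3) → ℂ) (A : (Fin n → ℂ) → Fin (n + 2) → Mat2) (i : Fin n)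
    (t : Fin n → ℂ) :
    t i * (t i - 1) * H θ t (A t) i = Hhat θ A i t - Chat θ i t := by
  rw [Chat_eq, H, Hhat, neg_one_mul, sub_neg_eq_add, ← mul_add, ← Finset.sum_add_distrib]
  congr 1
  refine Finset.sum_congr rfl fun j _ => ?_
  rw [pairing]
  ring

theorem th_shift_ix (θ : Fin (n + 3) → ℂ) (i : Fin n) :
    th (shift θ (ix0 n) (ix1 n)) (ix i) = th θ (ix i) := by
  have h0 := (ix0_ne_ix i).symm
  have h1 := (ix1_ne_ix i).symm
  simp [th, shift, h0, h1]

theorem th_shift_ix0 (θ : Fin (n + 3) → ℂ) :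
    th (shift θ (ix0 n) (ix1 n)) (ix0 n) = th θ (ix0 n) + 1 := by
  have h0 := ix0_ne_ix1 (n := n)
  simp [th, shift, h0]

theorem th_shift_ix1 (θ : Fin (n + 3) → ℂ) :
    th (shift θ (ix0 n) (ix1 n)) (ix1 n) = th θ (ix1 n) + 1 := by
  have h0 := (ix0_ne_ix1 (n := n)).symm
  simp [th, shift, h0]

/-- Two corrections combine: the change of the traces contributes `t_i θ_i - tr A_i R̂`, and the
shift of `θ_{n+1}` and `θ_{n+2}` in the products `θ_i θ_j / 2` contributes `-θ_i (2 t_i - 1) / 2`.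
Their sum no longer contains `t_i` explicitly. -/
theorem Hhat_T (hA : IsSolution θ U A) (ht : t ∈ U) (hp : Function.Injective (pts t))
    (hgen : wedge (A t) (ix0 n) (ix1 n) ≠ 0) (i : Fin n) :
    Hhat (shift θ (ix0 n) (ix1 n)) (fun t => T (pts t) (A t) (ix0 n) (ix1 n)) i t =
      Hhat θ A i t - hamDiff θ A i t := by
  have h0 := coord_ne_zero hp i
  have h1 := coord_sub_one_ne_zero hp i
  have key := trace_T_mul_sum (pts t) (A t) (ix0 n) (ix1 n) (ix i) hp ix0_ne_ix1
    (ix0_ne_ix i).symm (ix1_ne_ix i).symm (hA.det_eq t ht _) (hA.det_eq t ht _) hgen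
  rw [pts_ix0, pts_ix1, pts_ix, hA.trace_eq t ht] at key
  have hth : ∑ j ∈ Finset.univ.filter (fun j => j ≠ ix i), 1 / (t i - pts t j) *
        -(1 / 2 * th (shift θ (ix0 n) (ix1 n)) (ix i) * th (shift θ (ix0 n) (ix1 n)) j) =
      ∑ j ∈ Finset.univ.filter (fun j => j ≠ ix i), 1 / (t i - pts t j) *
        -(1 / 2 * th θ (ix i) * th θ j) - th θ (ix i) / 2 * (1 / t i + 1 / (t i - 1)) := by
    rw [sum_ne_ix, sum_ne_ix]
    simp only [th_shift_ix, th_shift_ix0, th_shift_ix1, pts_ix, pts_ix0, pts_ix1]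
    ring
  simp only [Hhat, pairing, mul_add, Finset.sum_add_distrib, pts_ix, hamDiff]
  rw [key, hth, Rhat]
  field_simp
  ring_nf

theorem dl_tau_eq {τ : (Fin n → ℂ) → ℂ} (hτ : IsTau θ U A τ) (ht : t ∈ U) (j : Fin n) :
    dl j τ t = (Hhat θ A j t - Chat θ j t) * τ t := by
  rw [← mul_H_eq, ← hτ.dlog t ht j, dl, mul_assoc (t j * (t j - 1)), div_mul_cancel₀ _ (hτ.ne_zero t ht)]

end Tau

/-! ### The identity free of τ-functions -/

section Reduced

variable {n : ℕ} {θ : Fin (n + 3) → ℂ} {U : Set (Fin n → ℂ)}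
  {A : (Fin n → ℂ) → Fin (n + 2) → Mat2} {t : Fin n → ℂ}

/-- Let `α = tr A_j A_i R̂`, `β = tr A_i A_j R̂` and `q = 2 t_i t_j - t_i - t_j`. Since `t_j (t_i -
1)` and `t_i (t_j - 1)` are `(q ± (t_i - t_j)) / 2`, the derivative of `x_i` splits into a multiple
of `α - β` with factor `q` and a multiple of `α + β`. Cayley–Hamilton with `tr R̂ = 1` cancels the
latter against the quadratic terms, leaving half the pairing. Adding `2 δ_j Ĥ_i` makes the
coefficient of the pairing `q² / (2 (t_i - t_j)²)`, so `2 / q` clears the denominator; finally `q =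
2 t_i (t_i - 1) - (2 t_i - 1) (t_i - t_j)`. -/
theorem reduced_term_of_ne (hA : IsSolution θ U A) (hU : IsOpen U) (ht : t ∈ U)
    (hp : Function.Injective (pts t))
    (hgen : ∀ t ∈ U, wedge (A t) (ix0 n) (ix1 n) ≠ 0) {i j : Fin n} (hij : i ≠ j)
    (hq : 2 * t i * t j - t i - t j ≠ 0) :
    2 / (2 * t i * t j - t i - t j) *
        (2 * dl j (Hhat θ A i) t - dl j (hamDiff θ A i) t + hamDiff θ A i t * hamDiff θ A j t) =
      2 * (t i * (t i - 1)) * (pairing θ (A t) (ix i) (ix j) / (t i - t j) ^ 2)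
        - (2 * t i - 1) * (1 / (t i - t j) * pairing θ (A t) (ix i) (ix j))
        + 1 / (t i - t j) *
          ((A t (ix j) * A t (ix i) - A t (ix i) * A t (ix j)) * Rhat A t).trace := by
  have h1 := coord_sub_ne_zero hp hij
  have h2 := coord_sub_ne_zero hp hij.symm
  obtain ⟨-, -, -, -, htr, -⟩ := Rhat_relations hA ht (hgen t ht)
  have hch := trace_mul_mul_add_trace_mul_mul (A t (ix i)) (A t (ix j)) (Rhat A t)
  rw [htr, hA.trace_eq t ht, hA.trace_eq t ht] at hch
  rw [dl_Hhat_of_ne hA hU ht hp hij, dl_hamDiff_of_ne hA hU ht hp hgen hij,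
    sub_mul (A t (ix j) * A t (ix i)), Matrix.trace_sub, hamDiff, hamDiff, pairing]
  generalize (A t (ix i) * A t (ix j) * Rhat A t).trace = β at *
  generalize (A t (ix j) * A t (ix i) * Rhat A t).trace = α at *
  obtain rfl : β = _ := eq_sub_of_add_eq hch
  have hneg : t j - t i = -(t i - t j) := by ring
  rw [hneg, div_mul_eq_mul_div, div_eq_iff hq]
  field_simp
  ring

/-- The diagonal term is a sum over all poles other than `t_i`, and its part over `t_1, …, t_n`
cancels the off-diagonal terms up to the share of `(2 t_i - 1) Ĥ_i`. The poles `0` and `1` leave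
`θ_{n+1} x_i / t_i` and `θ_{n+2} x_i / (t_i - 1)`. The last term arises from completing the square:
with `y = tr A_i R̂`, `x_i² - (y² - θ_i y) = θ_i² / 4`. -/
theorem reduced_identity (hA : IsSolution θ U A) (hU : IsOpen U) (ht : t ∈ U)
    (hp : Function.Injective (pts t))
    (hgen : ∀ t ∈ U, wedge (A t) (ix0 n) (ix1 n) ≠ 0) (i : Fin n)
    (hpole : ∀ j, 2 * t i * t j - t i - t j ≠ 0) :
    ∑ j, 2 / (2 * t i * t j - t i - t j) *
        (2 * dl j (Hhat θ A i) t - dl j (hamDiff θ A i) t + hamDiff θ A i t * hamDiff θ A j t) =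
      (th θ (ix0 n) / t i + th θ (ix1 n) / (t i - 1)) * hamDiff θ A i t
        + (2 * t i - 1) / (t i * (t i - 1)) * Hhat θ A i t
        + th θ (ix i) ^ 2 / (4 * (t i * (t i - 1))) := by
  have h0 := coord_ne_zero hp i
  have h1 := coord_sub_one_ne_zero hp i
  obtain ⟨r0, r1, r2, r3, -, -⟩ := Rhat_relations hA ht (hgen t ht)
  have e0 : ((A t (ix0 n) * A t (ix i) - A t (ix i) * A t (ix0 n)) * Rhat A t).trace =
      (A t (ix i) * A t (ix0 n)).trace - th θ (ix0 n) * (A t (ix i) * Rhat A t).trace := by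
    rw [sub_mul, Matrix.trace_sub, mul_assoc, mul_assoc, r2, Matrix.trace_mul_comm, mul_assoc, r0,
      mul_smul_comm, Matrix.trace_smul, smul_eq_mul]
  have e1 : ((A t (ix1 n) * A t (ix i) - A t (ix i) * A t (ix1 n)) * Rhat A t).trace =
      th θ (ix1 n) * th θ (ix i) - th θ (ix1 n) * (A t (ix i) * Rhat A t).trace
        - (A t (ix i) * A t (ix1 n)).trace := by
    rw [sub_mul, Matrix.trace_sub, mul_assoc, mul_assoc, r3, Matrix.trace_mul_comm, mul_assoc, r1,
      ← hA.trace_eq t ht (ix i)]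
    simp only [mul_add, mul_sub, mul_smul_comm, mul_one, mul_zero, Matrix.trace_add,
      Matrix.trace_sub, Matrix.trace_smul, Matrix.trace_zero, smul_eq_mul]
    ring
  rw [← Finset.add_sum_erase _ _ (Finset.mem_univ i), ← Finset.filter_ne',
    Finset.sum_congr rfl fun j hj => reduced_term_of_ne hA hU ht hp hgen
      (Finset.mem_filter.mp hj).2.symm (hpole j),
    Finset.sum_add_distrib, Finset.sum_sub_distrib, ← Finset.mul_sum, ← Finset.mul_sum,
    dl_Hhat_self hA hU ht hp, dl_hamDiff_self hA hU ht hp hgen, Hhat, hamDiff]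
  simp only [sum_ne_ix, pts_ix, pts_ix0, pts_ix1, e0, e1, sub_zero]
  -- On the diagonal the weight `2 / q` is `1 / (t_i (t_i - 1))`.
  have hq : 2 * t i * t i - t i - t i = 2 * (t i * (t i - 1)) := by ring
  rw [hq]
  generalize ∑ j ∈ Finset.univ.filter (fun j => j ≠ i),
    pairing θ (A t) (ix i) (ix j) / (t i - t j) ^ 2 = S₂
  generalize ∑ j ∈ Finset.univ.filter (fun j => j ≠ i),
    1 / (t i - t j) * pairing θ (A t) (ix i) (ix j) = S₁
  generalize ∑ j ∈ Finset.univ.filter (fun j => j ≠ i), 1 / (t i - t j) *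
    ((A t (ix j) * A t (ix i) - A t (ix i) * A t (ix j)) * Rhat A t).trace = S₃
  simp only [pairing]
  field_simp
  ring

end Reduced

end

end Schlesinger

/-! ### The bilinear equation -/

open Schlesinger in
theorem mainTheorem4 {n : ℕ} (θ : Fin (n + 3) → ℂ) (U : Set (Fin n → ℂ)) (hU : IsOpen U)
    (hconf : ∀ t ∈ U, Function.Injective (pts t))
    (A : (Fin n → ℂ) → Fin (n + 2) → Mat2) (hA : IsSolution θ U A)
    (hgen : ∀ t ∈ U, wedge (A t) (ix0 n) (ix1 n) ≠ 0)
    (τ₀ τ₁ : (Fin n → ℂ) → ℂ) (hτ₀ : IsTau θ U A τ₀)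
    (hτ₁ : IsTau (shift θ (ix0 n) (ix1 n)) U
      (fun t => T (pts t) (A t) (ix0 n) (ix1 n)) τ₁)
    (t : Fin n → ℂ) (ht : t ∈ U) (i : Fin n)
    (hpole : ∀ j, 2 * t i * t j - t i - t j ≠ 0) :
    (∑ j, 2 / (2 * t i * t j - t i - t j) *
        (hirota2 i j τ₀ τ₁ t + Fcoef θ i j t * hirota1 j τ₀ τ₁ t))
      + F0 θ i t * hirota1 i τ₀ τ₁ t
      - (2 * t i - 1) / (t i * (t i - 1)) * dl i τ₀ t * τ₁ t
      + F1 θ i t * τ₀ t * τ₁ t = 0 := by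
  have hp := hconf t ht
  have hdH (j : Fin n) : DifferentiableAt ℂ (Hhat θ A j) t := (hasPd_Hhat hA hU ht hp j j).1
  have hdx (j : Fin n) := differentiableAt_hamDiff hA hU ht hp hgen j
  have hdC (j : Fin n) := differentiableAt_Chat θ hp j
  have hdC' (j : Fin n) : DifferentiableAt ℂ (ChatStar θ j) t := differentiableAt_Chat _ hp j
  have hl₀ : ∀ s ∈ U, ∀ j, dl j τ₀ s = (fun s => Hhat θ A j s - Chat θ j s) s * τ₀ s :=
    fun s hs j => dl_tau_eq hτ₀ hs j
  have hl₁ : ∀ s ∈ U, ∀ j, dl j τ₁ s =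
      (fun s => Hhat θ A j s - hamDiff θ A j s - ChatStar θ j s) s * τ₁ s := fun s hs j => by
    rw [dl_tau_eq hτ₁ hs j, Hhat_T hA hs (hconf s hs) (hgen s hs)]
    -- `ChatStar` is `Chat` at the shifted exponents by definition.
    rfl
  have hs₀ (j : Fin n) := dl_dl_of_dl_eq_mul hU ht hτ₀.holo hl₀ i j ((hdH j).sub (hdC j))
  have hs₁ (j : Fin n) := dl_dl_of_dl_eq_mul hU ht hτ₁.holo hl₁ i j
    (((hdH j).sub (hdx j)).sub (hdC' j))
  -- With `c_i = Ĉ_i - Ĉ*_i`, the logarithmic derivative of `τ₀ / τ₁` is `x_i - c_i`, and `(x_i -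
  -- c_i) (x_j - c_j) + c_i (x_j - c_j) + c_j (x_i - c_i) + c_i c_j = x_i x_j`. The derivatives of
  -- `Ĉ_i + Ĉ*_i` cancel those in `δ_i δ_j log (τ₀ τ₁)`.
  have hterm (j : Fin n) :
      2 / (2 * t i * t j - t i - t j) *
          (hirota2 i j τ₀ τ₁ t + Fcoef θ i j t * hirota1 j τ₀ τ₁ t)
        + 2 * (Chat θ j t - ChatStar θ j t) / (2 * t i * t j - t i - t j) * hirota1 i τ₀ τ₁ t
        + 2 / (2 * t i * t j - t i - t j) * (dl j (fun s => Chat θ i s + ChatStar θ i s) t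
          + (Chat θ i t - ChatStar θ i t) * (Chat θ j t - ChatStar θ j t)) * (τ₀ t * τ₁ t) =
      2 / (2 * t i * t j - t i - t j) *
        (2 * dl j (Hhat θ A i) t - dl j (hamDiff θ A i) t + hamDiff θ A i t * hamDiff θ A j t) *
        (τ₀ t * τ₁ t) := by
    rw [hirota2, hirota1, hirota1, Fcoef, hs₀, hs₁, hl₀ t ht, hl₀ t ht, hl₁ t ht, hl₁ t ht,
      dl_sub (hdH j) (hdC j), dl_sub ((hdH j).fun_sub (hdx j)) (hdC' j),
      dl_sub (hdH j) (hdx j),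
      dl_add (hdC i) (hdC' i), dl_Hhat_comm hA hU ht hp j i, dl_hamDiff_comm hA hU ht hp hgen j i,
      dl_Chat_comm θ hp j i, show dl j (ChatStar θ i) t = dl i (ChatStar θ j) t from
        dl_Chat_comm _ hp j i]
    ring
  have hsum := Finset.sum_congr rfl fun j (_ : j ∈ Finset.univ) => hterm j
  rw [Finset.sum_add_distrib, Finset.sum_add_distrib, ← Finset.sum_mul, ← Finset.sum_mul,
    ← Finset.sum_mul, reduced_identity hA hU ht hp hgen i hpole] at hsum
  have hh : hirota1 i τ₀ τ₁ t =
      (hamDiff θ A i t - (Chat θ i t - ChatStar θ i t)) * (τ₀ t * τ₁ t) := by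
    rw [hirota1, hl₀ t ht, hl₁ t ht]
    ring
  have h0 := hl₀ t ht i
  rw [F0, F1]
  simp only at h0
  -- `hh` turns the terms in `θ_{n+1}` and `θ_{n+2}` of `F0` and `F1` into multiples of `x_i`; `h0`
  -- turns `δ_i τ₀` together with the `Ĉ_i` term of `F1` into `Ĥ_i τ₀`.
  linear_combination hsum - (th θ (ix0 n) / t i + th θ (ix1 n) / (t i - 1)) * hh
    - (2 * t i - 1) / (t i * (t i - 1)) * τ₁ t * h0
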